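/- **Setting.** Two teams of agents $\mathcal N^{(1)}$, $\mathcal N^{(2)}$ ($K_1$ and $K_2$ agents, $\mathcal N=\mathcal N^{(1)}\cup\mathcal N^{(2)}$) play a game with strategies $x\in\mathbb R^{M_1}$, $y\in\mathbb R^{M_2}$, $z=[x;y]$, and team objectives $J^{(t)}(x,y)=\sum_{k\in\mathcal N^{(t)}}p_kJ_k(x,y)$, $t=1,2$, both to be minimized (Team 1 over $x$, Team 2 over $y$). A Nash equilibrium is a point $z^\star=[x^\star;y^\star]$ with $J^{(1)}(x^\star,y^\star)\le J^{(1)}(x,y^\star)$ and $J^{(2)}(x^\star,y^\star)\le J^{(2)}(x^\star,y)$ for all $x,y$. Let $A^{(t)}=(a^{(t)}_{\ell k})$ be the $K_t\times K_t$ combination matrices and $C=(c_{\ell k})=[C^{(1)},C^{(12)};C^{(21)},C^{(2)}]$ the inference matrix indexed by all agents ($C^{(12)}$ has rows in Team 1 and columns in Team 2). A matrix is left-stochastic if it is entrywise nonnegative and its columns sum to one. With step size $\mu>0$ and stochastic gradients $\widehat{\nabla_xJ}_{k,i}$, $\widehat{\nabla_yJ}_{k,i}$, every agent $k$ keeps $(x_{k,i},y_{k,i})$,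 with $x_{k,-1}=0$, $y_{k,-1}=0$. At iteration $i=0,1,2,\dots$ (all stochastic gradients of agent $\ell$ being evaluated at $(x_{\ell,i-1},y_{\ell,i-1})$), in both algorithms $$x_{k,i}=\sum_{\ell\in\mathcal N^{(1)}}a^{(1)}_{\ell k}\bigl(x_{\ell,i-1}-\mu\widehat{\nabla_xJ}_{\ell,i}\bigr)\ (k\in\mathcal N^{(1)}),\qquad y_{k,i}=\sum_{\ell\in\mathcal N^{(2)}}a^{(2)}_{\ell k}\bigl(y_{\ell,i-1}-\mu\widehat{\nabla_yJ}_{\ell,i}\bigr)\ (k\in\mathcal N^{(2)}).$$ The estimates of the other team's strategy are, in **ATC-ITC**, $$y_{k,i}=\sum_{\ell\in\mathcal N^{(2)}}c_{\ell k}y_{\ell,i}+\sum_{\ell\in\mathcal N^{(1)}}c_{\ell k}\bigl(y_{\ell,i-1}+\mu\widehat{\nabla_yJ}_{\ell,i}\bigr)\ (k\in\mathcal N^{(1)}),$$ $$x_{k,i}=\sum_{\ell\in\mathcal N^{(1)}}c_{\ell k}x_{\ell,i}+\sum_{\ell\in\mathcal N^{(2)}}c_{\ell k}\bigl(x_{\ell,i-1}+\mu\widehat{\nabla_xJ}_{\ell,i}\bigr)\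 (k\in\mathcal N^{(2)}),$$ and in **ATC-C** only the first sum is kept in each of these two formulas. The centroid is $z_{c,i}=[\sum_{k\in\mathcal N^{(1)}}p_kx_{k,i};\ \sum_{k\in\mathcal N^{(2)}}p_ky_{k,i}]$, and $z_{k,i}=[x_{k,i};y_{k,i}]$. **Assumptions.** (1) $A^{(1)},A^{(2)}$ are primitive and left-stochastic, and $(p_k)_{k\in\mathcal N^{(t)}}$ is the Perron eigenvector of $A^{(t)}$ (positive entries, sum one, $A^{(t)}p^{(t)}=p^{(t)}$). (2) Either *(ATC-ITC, zero-sum game, weak cross-team matrix)* the algorithm is ATC-ITC, $J^{(1)}=-J^{(2)}$, $C$ is left-stochastic, $C^{(1)}$ and $C^{(2)}$ are irreducible, and each of $C^{(12)}$, $C^{(21)}$ has a positive entry; or *(ATC-C, general game, strong cross-team matrix)* the algorithm is ATC-C, $C^{(1)}=0$, $C^{(2)}=0$, and $C^{(12)}$, $C^{(21)}$ are left-stochastic. (3) $F(z)=[\nabla_xJ^{(1)}(z);\nabla_yJ^{(2)}(z)]$ is $\nu$-strongly monotone with $\nu>0$: $(F(z_1)-F(z_2))^\top(z_1-z_2)\ge\nu\|z_1-z_2\|^2$.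 (4) The $J_k$ are differentiable and $\|\nabla_wJ_k(x_1,y_1)-\nabla_wJ_k(x_2,y_2)\|\le L_f(\|x_1-x_2\|+\|y_1-y_2\|)$ for $w=x,y$ and all $k$. (5) $\|\nabla_wJ_k-\nabla_wJ^{(t)}\|\le G$ everywhere, for $k\in\mathcal N^{(t)}$, $w=x,y$. (6) With $\mathcal F_{i}$ the $\sigma$-algebra generated by all $(x_{k,j},y_{k,j})$, $k\in\mathcal N$, $-1\le j\le i$, the stochastic gradients satisfy, for all $i\ge0$, $k\in\mathcal N$ and $w=x,y$, $\mathbb E[\widehat{\nabla_wJ}_{k,i}(x_{k,i-1},y_{k,i-1})\mid\mathcal F_{i-1}]=\nabla_wJ_k(x_{k,i-1},y_{k,i-1})$ and $\mathbb E[\|\widehat{\nabla_wJ}_{k,i}(x_{k,i-1},y_{k,i-1})-\nabla_wJ_k(x_{k,i-1},y_{k,i-1})\|^2\mid\mathcal F_{i-1}]\le\sigma^2$. **Theorem 1 (mean-square-error stability).** There are a function $d=d(\mu,\nu,L_f)$, a number $\alpha\in(0,1)$ that depends only on the algorithm and on $A^{(1)},A^{(2)},C$, and constants $\mu_0>0$,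 $B$, $c>0$ that depend only on the algorithm, the dimensions, $A^{(1)},A^{(2)},C$ and $\nu,L_f,G,\sigma$, such that under these assumptions the game has exactly one Nash equilibrium $z^\star$, and for every step size $0<\mu<\mu_0$: $0\le d(\mu,\nu,L_f)<1$, all the mean-square errors below are finite, and 1. for every iteration $i\ge0$ with $i\ge i_\alpha:=\log(c\mu^2)/\log\alpha$, $$\mathbb E\|z_{c,i}-z^\star\|^2\le d(\mu,\nu,L_f)\,\mathbb E\|z_{c,i-1}-z^\star\|^2+B\mu^2;$$ 2. $\limsup_{i\to\infty}\mathbb E\|z_{c,i}-z^\star\|^2\le B\mu$; 3. $\limsup_{i\to\infty}\mathbb E\|z_{k,i}-z^\star\|^2\le B\mu$ for every agent $k\in\mathcal N$. -/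

import Mathlib

open MeasureTheory Filter

noncomputable section

namespace TwoTeam

/-- The agents of the two teams: `Sum.inl k` is agent `k` of Team 1, `Sum.inr k` is agent `k` of
Team 2. -/
abbrev Agent (K₁ K₂ : ℕ) : Type := Fin K₁ ⊕ Fin K₂

/-- Strategies: column vectors with the Euclidean norm. -/
abbrev Vec (M : ℕ) : Type := EuclideanSpace ℝ (Fin M)

/-- Joint strategies `z = [x; y]` with the Euclidean norm. -/
abbrev Joint (M₁ M₂ : ℕ) : Type := WithLp 2 (Vec M₁ × Vec M₂)

/-- The column vector `[x; y]`. -/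
def col {M₁ M₂ : ℕ} (x : Vec M₁) (y : Vec M₂) : Joint M₁ M₂ := WithLp.toLp 2 (x, y)

/-! ### Combination and inference matrices -/

/-- Left-stochastic: nonnegative entries, every column sums to one. -/
def LeftStochastic {m n : Type*} [Fintype m] (A : Matrix m n ℝ) : Prop :=
  (∀ i j, 0 ≤ A i j) ∧ ∀ j, ∑ i, A i j = 1

/-- `p` is the Perron eigenvector of `A`: positive entries, total sum one, `A p = p`. -/
def IsPerronVector {n : Type*} [Fintype n] (A : Matrix n n ℝ) (p : n → ℝ) : Prop :=
  (∀ k, 0 < p k) ∧ ∑ k, p k = 1 ∧ A.mulVec p = p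

/-- A within-team combination matrix. -/
def WithinTeam {n : Type*} [Fintype n] [DecidableEq n] (A : Matrix n n ℝ) : Prop :=
  A.IsPrimitive ∧ LeftStochastic A

variable {K₁ K₂ M₁ M₂ : ℕ}

/-- Strong cross-team inference matrix: zero diagonal blocks, left-stochastic off-diagonal
blocks. -/
def StrongCrossTeam (C : Matrix (Agent K₁ K₂) (Agent K₁ K₂) ℝ) : Prop :=
  C.toBlocks₁₁ = 0 ∧ C.toBlocks₂₂ = 0 ∧
    LeftStochastic C.toBlocks₁₂ ∧ LeftStochastic C.toBlocks₂₁

/-- Weak cross-team inference matrix: left-stochastic, irreducible diagonal blocks, and at least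
one link from each team to the other one. -/
def WeakCrossTeam (C : Matrix (Agent K₁ K₂) (Agent K₁ K₂) ℝ) : Prop :=
  LeftStochastic C ∧ C.toBlocks₁₁.IsIrreducible ∧ C.toBlocks₂₂.IsIrreducible ∧
    (∃ (k : Fin K₁) (l : Fin K₂), 0 < C (Sum.inr l) (Sum.inl k)) ∧
    (∃ (k : Fin K₂) (l : Fin K₁), 0 < C (Sum.inl l) (Sum.inr k))

/-! ### The game -/

/-- Global objective of Team 1. -/
def teamCost₁ (p : Agent K₁ K₂ → ℝ) (J : Agent K₁ K₂ → Vec M₁ → Vec M₂ → ℝ)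
    (x : Vec M₁) (y : Vec M₂) : ℝ :=
  ∑ k : Fin K₁, p (Sum.inl k) * J (Sum.inl k) x y

/-- Global objective of Team 2. -/
def teamCost₂ (p : Agent K₁ K₂ → ℝ) (J : Agent K₁ K₂ → Vec M₁ → Vec M₂ → ℝ)
    (x : Vec M₁) (y : Vec M₂) : ℝ :=
  ∑ k : Fin K₂, p (Sum.inr k) * J (Sum.inr k) x y

/-- Global objective of the team to which agent `k` belongs. -/
def ownTeamCost (p : Agent K₁ K₂ → ℝ) (J : Agent K₁ K₂ → Vec M₁ → Vec M₂ → ℝ) :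
    Agent K₁ K₂ → Vec M₁ → Vec M₂ → ℝ
  | Sum.inl _ => teamCost₁ p J
  | Sum.inr _ => teamCost₂ p J

/-- The partial gradient `∇ₓ f (x, y)`. -/
def gradX (f : Vec M₁ → Vec M₂ → ℝ) (x : Vec M₁) (y : Vec M₂) : Vec M₁ :=
  gradient (fun x' => f x' y) x

/-- The partial gradient `∇_y f (x, y)`. -/
def gradY (f : Vec M₁ → Vec M₂ → ℝ) (x : Vec M₁) (y : Vec M₂) : Vec M₂ :=
  gradient (fun y' => f x y') y

/-- The game operator `F(z) = [∇ₓ J⁽¹⁾(x, y); ∇_y J⁽²⁾(x, y)]`. -/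
def gameOperator (p : Agent K₁ K₂ → ℝ) (J : Agent K₁ K₂ → Vec M₁ → Vec M₂ → ℝ)
    (z : Joint M₁ M₂) : Joint M₁ M₂ :=
  col (gradX (teamCost₁ p J) z.fst z.snd) (gradY (teamCost₂ p J) z.fst z.snd)

/-- Nash equilibria of the two-team game. -/
def IsNash (p : Agent K₁ K₂ → ℝ) (J : Agent K₁ K₂ → Vec M₁ → Vec M₂ → ℝ)
    (z : Joint M₁ M₂) : Prop :=
  (∀ x, teamCost₁ p J z.fst z.snd ≤ teamCost₁ p J x z.snd) ∧
    ∀ y, teamCost₂ p J z.fst z.snd ≤ teamCost₂ p J z.fst y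

/-- `J⁽¹⁾ = - J⁽²⁾`. -/
def ZeroSum (p : Agent K₁ K₂ → ℝ) (J : Agent K₁ K₂ → Vec M₁ → Vec M₂ → ℝ) : Prop :=
  ∀ x y, teamCost₁ p J x y = - teamCost₂ p J x y

/-- The game operator is `ν`-strongly monotone. -/
def StronglyMonotone (p : Agent K₁ K₂ → ℝ) (J : Agent K₁ K₂ → Vec M₁ → Vec M₂ → ℝ)
    (ν : ℝ) : Prop :=
  ∀ z₁ z₂ : Joint M₁ M₂,
    ν * ‖z₁ - z₂‖ ^ 2 ≤ inner ℝ (gameOperator p J z₁ - gameOperator p J z₂) (z₁ - z₂)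

/-- Every local risk function is differentiable and its partial gradients are
`Lf`-Lipschitz. -/
def LipschitzGradients (J : Agent K₁ K₂ → Vec M₁ → Vec M₂ → ℝ) (Lf : ℝ) : Prop :=
  ∀ k, Differentiable ℝ (fun z : Vec M₁ × Vec M₂ => J k z.1 z.2) ∧
    ∀ x₁ x₂ y₁ y₂,
      ‖gradX (J k) x₁ y₁ - gradX (J k) x₂ y₂‖ ≤ Lf * (‖x₁ - x₂‖ + ‖y₁ - y₂‖) ∧
      ‖gradY (J k) x₁ y₁ - gradY (J k) x₂ y₂‖ ≤ Lf * (‖x₁ - x₂‖ + ‖y₁ - y₂‖)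

/-- The gradients of each local risk function differ by at most `G` from those of the global
objective of the agent's team. -/
def BoundedDisagreement (p : Agent K₁ K₂ → ℝ) (J : Agent K₁ K₂ → Vec M₁ → Vec M₂ → ℝ)
    (G : ℝ) : Prop :=
  ∀ k x y, ‖gradX (J k) x y - gradX (ownTeamCost p J k) x y‖ ≤ G ∧
    ‖gradY (J k) x y - gradY (ownTeamCost p J k) x y‖ ≤ G

/-! ### The algorithms -/

/-- The two learning strategies. -/
inductive Method where
  /-- Adapt-then-combine and infer-then-combine. -/
  | atcItc
  /-- Adapt-then-combine and combine. -/
  | atcC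

/-- ATC-ITC is run on a weak cross-team subgraph, ATC-C on a strong one. -/
def Method.CrossTeam : Method → Matrix (Agent K₁ K₂) (Agent K₁ K₂) ℝ → Prop
  | .atcItc => WeakCrossTeam
  | .atcC => StrongCrossTeam

/-- ATC-ITC is run on zero-sum games, ATC-C on arbitrary ones. -/
def Method.GameClass : Method → (Agent K₁ K₂ → ℝ) → (Agent K₁ K₂ → Vec M₁ → Vec M₂ → ℝ) → Prop
  | .atcItc => ZeroSum
  | .atcC => fun _ _ => True

/-- The strategy pairs `(x_k, y_k)` of all agents. For an agent of Team 1, `x_k` is its own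
strategy and `y_k` its estimate of the strategy of Team 2; the other way round for Team 2. -/
abbrev State (K₁ K₂ M₁ M₂ : ℕ) : Type := Agent K₁ K₂ → Vec M₁ × Vec M₂

/-- Adapt-then-combine update of the strategies of Team 1. -/
def ownX (A₁ : Matrix (Fin K₁) (Fin K₁) ℝ) (μ : ℝ) (gx : Agent K₁ K₂ → Vec M₁ → Vec M₂ → Vec M₁)
    (s : State K₁ K₂ M₁ M₂) (k : Fin K₁) : Vec M₁ :=
  ∑ l : Fin K₁, A₁ l k •
    ((s (Sum.inl l)).1 - μ • gx (Sum.inl l) (s (Sum.inl l)).1 (s (Sum.inl l)).2)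

/-- Adapt-then-combine update of the strategies of Team 2. -/
def ownY (A₂ : Matrix (Fin K₂) (Fin K₂) ℝ) (μ : ℝ) (gy : Agent K₁ K₂ → Vec M₁ → Vec M₂ → Vec M₂)
    (s : State K₁ K₂ M₁ M₂) (k : Fin K₂) : Vec M₂ :=
  ∑ l : Fin K₂, A₂ l k •
    ((s (Sum.inr l)).2 - μ • gy (Sum.inr l) (s (Sum.inr l)).1 (s (Sum.inr l)).2)

/-- One iteration of a method with step size `μ` and stochastic gradients `gx`, `gy`. In the
inference step Team 1 uses `-∇_y J_k` as a proxy for `∇_y J⁽²⁾` and Team 2 uses `-∇ₓ J_k` as a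
proxy for `∇ₓ J⁽¹⁾`. -/
def Method.step (A₁ : Matrix (Fin K₁) (Fin K₁) ℝ) (A₂ : Matrix (Fin K₂) (Fin K₂) ℝ)
    (C : Matrix (Agent K₁ K₂) (Agent K₁ K₂) ℝ) (μ : ℝ)
    (gx : Agent K₁ K₂ → Vec M₁ → Vec M₂ → Vec M₁)
    (gy : Agent K₁ K₂ → Vec M₁ → Vec M₂ → Vec M₂) (s : State K₁ K₂ M₁ M₂) :
    Method → State K₁ K₂ M₁ M₂
  | .atcItc => fun
    | Sum.inl k =>
      (ownX A₁ μ gx s k,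
        ∑ l : Fin K₂, C (Sum.inr l) (Sum.inl k) • ownY A₂ μ gy s l +
        ∑ l : Fin K₁, C (Sum.inl l) (Sum.inl k) •
          ((s (Sum.inl l)).2 + μ • gy (Sum.inl l) (s (Sum.inl l)).1 (s (Sum.inl l)).2))
    | Sum.inr k =>
      (∑ l : Fin K₁, C (Sum.inl l) (Sum.inr k) • ownX A₁ μ gx s l +
        ∑ l : Fin K₂, C (Sum.inr l) (Sum.inr k) •
          ((s (Sum.inr l)).1 + μ • gx (Sum.inr l) (s (Sum.inr l)).1 (s (Sum.inr l)).2),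
        ownY A₂ μ gy s k)
  | .atcC => fun
    | Sum.inl k =>
      (ownX A₁ μ gx s k, ∑ l : Fin K₂, C (Sum.inr l) (Sum.inl k) • ownY A₂ μ gy s l)
    | Sum.inr k =>
      (∑ l : Fin K₁, C (Sum.inl l) (Sum.inr k) • ownX A₁ μ gx s l, ownY A₂ μ gy s k)

variable {Ω : Type*}

/-- The random iterates of a method, started from zero. The state with index `n` is the one after
`n` iterations, so that iteration `i = 0, 1, 2, …` leads from state `i` to state `i + 1`.
`gx i k` and `gy i k` are the (random) stochastic gradients of agent `k` at iteration `i`. -/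
def Method.iterates (m : Method) (A₁ : Matrix (Fin K₁) (Fin K₁) ℝ)
    (A₂ : Matrix (Fin K₂) (Fin K₂) ℝ) (C : Matrix (Agent K₁ K₂) (Agent K₁ K₂) ℝ) (μ : ℝ)
    (gx : ℕ → Agent K₁ K₂ → Ω → Vec M₁ → Vec M₂ → Vec M₁)
    (gy : ℕ → Agent K₁ K₂ → Ω → Vec M₁ → Vec M₂ → Vec M₂) : ℕ → Ω → State K₁ K₂ M₁ M₂
  | 0 => fun _ _ => 0
  | i + 1 => fun ω =>
      Method.step A₁ A₂ C μ (fun k => gx i k ω) (fun k => gy i k ω)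
        (m.iterates A₁ A₂ C μ gx gy i ω) m

/-- The `σ`-algebra generated by the iterates of all agents up to the state with index `n`. -/
@[reducible] def history (s : ℕ → Ω → State K₁ K₂ M₁ M₂) (n : ℕ) : MeasurableSpace Ω :=
  ⨆ j ≤ n, MeasurableSpace.comap (s j) inferInstance

/-- The stochastic gradients are measurable random fields; at the iterates at which they are
evaluated they are conditionally unbiased given the past iterates, and their errors are square
integrable with conditional second moment at most `σ²`. -/
structure GradientNoise [MeasurableSpace Ω] (P : Measure Ω)
    (J : Agent K₁ K₂ → Vec M₁ → Vec M₂ → ℝ)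
    (gx : ℕ → Agent K₁ K₂ → Ω → Vec M₁ → Vec M₂ → Vec M₁)
    (gy : ℕ → Agent K₁ K₂ → Ω → Vec M₁ → Vec M₂ → Vec M₂)
    (s : ℕ → Ω → State K₁ K₂ M₁ M₂) (σ : ℝ) : Prop where
  measurable_x : ∀ i k, Measurable fun q : Ω × Vec M₁ × Vec M₂ => gx i k q.1 q.2.1 q.2.2
  measurable_y : ∀ i k, Measurable fun q : Ω × Vec M₁ × Vec M₂ => gy i k q.1 q.2.1 q.2.2
  unbiased_x : ∀ i k,
    P[fun ω => gx i k ω (s i ω k).1 (s i ω k).2 | history s i]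
      =ᵐ[P] fun ω => gradX (J k) (s i ω k).1 (s i ω k).2
  unbiased_y : ∀ i k,
    P[fun ω => gy i k ω (s i ω k).1 (s i ω k).2 | history s i]
      =ᵐ[P] fun ω => gradY (J k) (s i ω k).1 (s i ω k).2
  integrable_x : ∀ i k, Integrable (fun ω =>
    ‖gx i k ω (s i ω k).1 (s i ω k).2 - gradX (J k) (s i ω k).1 (s i ω k).2‖ ^ 2) P
  integrable_y : ∀ i k, Integrable (fun ω =>
    ‖gy i k ω (s i ω k).1 (s i ω k).2 - gradY (J k) (s i ω k).1 (s i ω k).2‖ ^ 2) P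
  variance_x : ∀ i k, ∀ᵐ ω ∂P,
    (P[fun ω => ‖gx i k ω (s i ω k).1 (s i ω k).2 - gradX (J k) (s i ω k).1 (s i ω k).2‖ ^ 2
      | history s i]) ω ≤ σ ^ 2
  variance_y : ∀ i k, ∀ᵐ ω ∂P,
    (P[fun ω => ‖gy i k ω (s i ω k).1 (s i ω k).2 - gradY (J k) (s i ω k).1 (s i ω k).2‖ ^ 2
      | history s i]) ω ≤ σ ^ 2

/-- The centroid `z_c = [x_c; y_c]`: the `p`-weighted averages of the own strategies of the two
teams. -/
def centroid (p : Agent K₁ K₂ → ℝ) (s : State K₁ K₂ M₁ M₂) : Joint M₁ M₂ :=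
  col (∑ k : Fin K₁, p (Sum.inl k) • (s (Sum.inl k)).1)
    (∑ k : Fin K₂, p (Sum.inr k) • (s (Sum.inr k)).2)

/-- The iterate `z_k = [x_k; y_k]` of agent `k`. -/
def agentIterate (k : Agent K₁ K₂) (s : State K₁ K₂ M₁ M₂) : Joint M₁ M₂ :=
  col (s k).1 (s k).2

/-- The mean-square error `E ‖Z - z*‖²`. -/
def mse [MeasurableSpace Ω] (P : Measure Ω) (Z : Ω → Joint M₁ M₂) (zs : Joint M₁ M₂) : ℝ :=
  ∫ ω, ‖Z ω - zs‖ ^ 2 ∂P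

end TwoTeam

end

noncomputable section

namespace TwoTeam

/-! ### Powers of left-stochastic matrices. -/

section Matrices

/-! Every agent holds a copy of both strategies, either its own or an estimate. All copies of one
team's strategy obey a single linear recursion `x ↦ Bᵀ (x + μ · drive)`, where `B` is `mixX` or
`mixY`: block triangular, left-stochastic, with fixed vector `q` the Perron vector of that team
extended by zero. The connectivity assumptions give some power of `B` a positive row, so `Bⁿ → q 1ᵀ`
with summable errors (`LeftStochastic.exists_sum_abs_pow_sub_le`).

In the deviation of a copy from the `q`-average, any drift common to all agents cancels. Take as
common drift minus the team gradient at the centroid. What remains is noise, the bound `G`, and `Lf`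
times the deviation itself. For estimating agents this uses the zero-sum property in ATC-ITC,
whereas in ATC-C their drive is never transmitted. Summability of the mixing errors and smallness of
`μ` close an induction: all deviations are `O(μ)` in `L²`, uniformly in time and without a
transient, since all copies start equal (`GradientNoise.l2Le_disagreement`).

The centroid performs `z ↦ z - μ F(z)` up to an `O(μ)` gradient error and zero-mean noise. Strong
monotonicity and the Lipschitz bound contract the first part, Young's inequality absorbs the second,
and the noise is orthogonal to the past, which gives the recursion with factor `1 - μν/2` and
remainder `O(μ²)` (`GradientNoise.mse_centroid_succ_le`); iterating it leaves `O(μ)`. The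
equilibrium is the unique zero of `F`, found by Banach's fixed point theorem.

Only `A` is stochastic in the next lemma: the cross-team block used as `B` may have column sums
below one. -/

theorem LeftStochastic.mul {N m n : Type*} [Fintype m] [Fintype n] {A : Matrix m n ℝ}
    {B : Matrix n N ℝ} (hA : LeftStochastic A) (hB : ∀ i j, 0 ≤ B i j) :
    (∀ i j, 0 ≤ (A * B) i j) ∧ ∀ j, ∑ i, (A * B) i j = ∑ i, B i j := by
  refine ⟨fun i j => Finset.sum_nonneg fun l _ => mul_nonneg (hA.1 _ _) (hB _ _), fun j => ?_⟩
  simp only [Matrix.mul_apply]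
  rw [Finset.sum_comm]
  simp [← Finset.sum_mul, hA.2]

variable {N : Type*} [Fintype N] [DecidableEq N]

theorem LeftStochastic.pow {B : Matrix N N ℝ} (hB : LeftStochastic B) (n : ℕ) :
    LeftStochastic (B ^ n) := by
  induction n with
  | zero =>
    refine ⟨fun i j => ?_, fun j => ?_⟩
    · rw [pow_zero, Matrix.one_apply]; split_ifs <;> norm_num
    · simp [Matrix.one_apply]
  | succ n ih =>
    rw [pow_succ]
    exact ⟨(ih.mul hB.1).1, fun j => ((ih.mul hB.1).2 j).trans (hB.2 j)⟩

/-- A left-stochastic matrix with a row bounded below by `ε` contracts the `ℓ¹` norm of vectors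
with zero sum. -/
theorem LeftStochastic.sum_abs_mulVec_le {P : Matrix N N ℝ} (hP : LeftStochastic P) {r : N} {ε : ℝ}
    (hr : ∀ k, ε ≤ P r k) {w : N → ℝ} (hw : ∑ k, w k = 0) :
    ∑ l, |P.mulVec w l| ≤ (1 - ε) * ∑ k, |w k| := by
  -- Doeblin's argument: subtracting the constant `ε` from row `r` does not change the action on
  -- zero-sum vectors, and it leaves a nonnegative matrix with column sums `1 - ε`.
  set Q : N → N → ℝ := fun l k => P l k - if l = r then ε else 0 with hQ
  have hQ0 : ∀ l k, 0 ≤ Q l k := by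
    intro l k
    simp only [hQ]
    split_ifs with h
    · subst h; linarith [hr k]
    · linarith [hP.1 l k]
  have hPQ : ∀ l, P.mulVec w l = ∑ k, Q l k * w k := by
    intro l
    simp only [hQ, sub_mul, Finset.sum_sub_distrib, ← Finset.mul_sum, hw, mul_zero, sub_zero]
    rfl
  calc ∑ l, |P.mulVec w l| ≤ ∑ l, ∑ k, Q l k * |w k| := by
        refine Finset.sum_le_sum fun l _ => ?_
        rw [hPQ]
        refine (Finset.abs_sum_le_sum_abs _ _).trans_eq (Finset.sum_congr rfl fun k _ => ?_)
        rw [abs_mul, abs_of_nonneg (hQ0 l k)]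
    _ = (1 - ε) * ∑ k, |w k| := by
        rw [Finset.sum_comm, Finset.mul_sum]
        refine Finset.sum_congr rfl fun k _ => ?_
        rw [← Finset.sum_mul]
        simp [hQ, hP.2]

theorem mulVec_pow_eq_self {B : Matrix N N ℝ} {q : N → ℝ} (h : B.mulVec q = q) (n : ℕ) :
    (B ^ n).mulVec q = q := by
  induction n with
  | zero => simp
  | succ n ih => rw [pow_succ, ← Matrix.mulVec_mulVec, h, ih]

/-- If some power of a left-stochastic matrix has a positive row, then its powers converge to the
rank-one matrix `q 1ᵀ` so fast that the distances are summable. -/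
theorem LeftStochastic.exists_sum_abs_pow_sub_le {B : Matrix N N ℝ} (hB : LeftStochastic B)
    {q : N → ℝ} (hq : ∑ l, q l = 1) (hBq : B.mulVec q = q)
    (hpos : ∃ n r, ∀ k, 0 < (B ^ n) r k) :
    ∃ S, 0 ≤ S ∧ ∀ n l k, ∑ i ∈ Finset.range n, |(B ^ (i + 1)) l k - q l| ≤ S := by
  obtain ⟨n₀, r, hr⟩ := hpos
  have : Nonempty N := ⟨r⟩
  obtain ⟨k₀, hk₀⟩ := Finite.exists_min fun k => (B ^ n₀) r k
  set ε := (B ^ n₀) r k₀ with hε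
  have hε0 : 0 < ε := hr k₀
  set c : ℕ → ℝ := fun n => ∑ k, ∑ l, |(B ^ n) l k - q l| with hc
  have hc0 : ∀ n, 0 ≤ c n := fun n =>
    Finset.sum_nonneg fun k _ => Finset.sum_nonneg fun l _ => abs_nonneg _
  have hstep : ∀ n, c (n₀ + n) ≤ (1 - ε) * c n := by
    intro n
    simp only [hc, Finset.mul_sum]
    refine Finset.sum_le_sum fun k _ => ?_
    rw [← Finset.mul_sum]
    -- Each column of `Bⁿ - q 1ᵀ` has zero sum, and `B ^ n₀` fixes `q`, so the contraction applies
    -- column by column.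
    have h1 : ∑ l, ((B ^ n) l k - q l) = 0 := by
      rw [Finset.sum_sub_distrib, (hB.pow n).2, hq, sub_self]
    refine le_of_eq_of_le (Finset.sum_congr rfl fun l _ => ?_)
      ((hB.pow n₀).sum_abs_mulVec_le hk₀ h1)
    congr 1
    have h2 := congrFun (mulVec_pow_eq_self hBq n₀) l
    simp only [Matrix.mulVec, dotProduct] at h2 ⊢
    simp only [mul_sub, Finset.sum_sub_distrib, h2, pow_add, Matrix.mul_apply]
  set s : ℕ → ℝ := fun n => ∑ i ∈ Finset.range n, c i with hs
  have hs0 : ∀ n, 0 ≤ s n := fun n => Finset.sum_nonneg fun i _ => hc0 i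
  -- Summing `hstep` gives `s n ≤ s (n₀ + n) ≤ s n₀ + (1 - ε) s n`, which is solved for `s n`; no
  -- explicit geometric rate is needed.
  have hbound : ∀ n, s n ≤ s n₀ / ε := by
    intro n
    have h1 : s (n₀ + n) ≤ s n₀ + (1 - ε) * s n := by
      simp only [hs]
      rw [Finset.sum_range_add, Finset.mul_sum]
      gcongr
      exact hstep _
    have h2 : s n ≤ s (n₀ + n) :=
      Finset.sum_le_sum_of_subset_of_nonneg (Finset.range_mono (Nat.le_add_left _ _))
        fun i _ _ => hc0 i
    rw [le_div_iff₀ hε0]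
    linarith
  refine ⟨s n₀ / ε, div_nonneg (hs0 _) hε0.le, fun n l k => ?_⟩
  refine le_trans ?_ (hbound (n + 1))
  simp only [hs]
  rw [Finset.sum_range_succ']
  refine le_add_of_le_of_nonneg (Finset.sum_le_sum fun i _ => ?_) (hc0 0)
  simp only [hc]
  refine le_trans ?_ (Finset.single_le_sum (f := fun k => ∑ l, |(B ^ (i + 1)) l k - q l|)
    (fun k _ => Finset.sum_nonneg fun l _ => abs_nonneg _) (Finset.mem_univ k))
  exact Finset.single_le_sum (f := fun l => |(B ^ (i + 1)) l k - q l|)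
    (fun l _ => abs_nonneg _) (Finset.mem_univ l)

/-- The entry `(r, k)` of the powers of `B` is eventually positive. -/
def EventuallyPos (B : Matrix N N ℝ) (r k : N) : Prop := ∃ n₀, ∀ n ≥ n₀, 0 < (B ^ n) r k

theorem LeftStochastic.pow_succ_pos {B : Matrix N N ℝ} (hB : LeftStochastic B) {r k k' : N} {n : ℕ}
    (h : 0 < (B ^ n) r k) (hk : 0 < B k k') : 0 < (B ^ (n + 1)) r k' := by
  rw [pow_succ, Matrix.mul_apply]
  exact Finset.sum_pos' (fun l _ => mul_nonneg ((hB.pow n).1 _ _) (hB.1 _ _))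
    ⟨k, Finset.mem_univ k, mul_pos h hk⟩

theorem EventuallyPos.step {B : Matrix N N ℝ} (hB : LeftStochastic B) {r k k' : N}
    (h : EventuallyPos B r k) (hk : 0 < B k k') : EventuallyPos B r k' := by
  obtain ⟨n₀, hn⟩ := h
  refine ⟨n₀ + 1, fun n hn1 => ?_⟩
  obtain ⟨n, rfl⟩ : ∃ m, n = m + 1 := ⟨n - 1, by omega⟩
  exact hB.pow_succ_pos (hn n (by omega)) hk

/-- Positivity for all large exponents, not just for one, lets the finitely many columns share an
exponent. -/
theorem exists_forall_pow_pos {B : Matrix N N ℝ} {r : N}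
    (h : ∀ k, EventuallyPos B r k) : ∃ n r, ∀ k, 0 < (B ^ n) r k := by
  choose n₀ hn using h
  exact ⟨∑ k, n₀ k, r, fun k => hn k _
    (Finset.single_le_sum (f := n₀) (fun _ _ => Nat.zero_le _) (Finset.mem_univ k))⟩

theorem LeftStochastic.exists_pos {m n : Type*} [Fintype m] {A : Matrix m n ℝ}
    (hA : LeftStochastic A) (j : n) : ∃ i, 0 < A i j := by
  by_contra! h
  have := Finset.sum_nonpos fun i (_ : i ∈ Finset.univ) => h i
  rw [hA.2 j] at this
  linarith

/-- Once a power is entrywise positive all later ones are, since no column of `A` vanishes. -/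
theorem WithinTeam.eventuallyPos {α : Type*} [Fintype α] [DecidableEq α] {A : Matrix α α ℝ}
    (hA : WithinTeam A) (i j : α) : EventuallyPos A i j := by
  obtain ⟨n₀, -, hn⟩ := hA.1.exists_pos_pow
  refine ⟨n₀, fun n hn0 => ?_⟩
  induction n, hn0 using Nat.le_induction generalizing j with
  | base => exact hn i j
  | succ n _ ih =>
    obtain ⟨l, hl⟩ := hA.2.exists_pos j
    exact hA.2.pow_succ_pos (ih l) hl

/-- Walks that stay in the image of `f` are among all walks, and every walk has nonnegative weight.
-/
theorem LeftStochastic.le_pow_apply {α : Type*} [Fintype α] [DecidableEq α] {A : Matrix α α ℝ}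
    {B : Matrix N N ℝ} (hB : LeftStochastic B) (hA : ∀ i j, 0 ≤ A i j) {f : α → N}
    (hf : f.Injective) (hAB : ∀ i j, A i j ≤ B (f i) (f j)) (n : ℕ) (i j : α) :
    (A ^ n) i j ≤ (B ^ n) (f i) (f j) := by
  induction n generalizing j with
  | zero => simp [Matrix.one_apply, hf.eq_iff]
  | succ n ih =>
    rw [pow_succ, pow_succ, Matrix.mul_apply, Matrix.mul_apply]
    calc ∑ l, (A ^ n) i l * A l j ≤ ∑ l, (B ^ n) (f i) (f l) * B (f l) (f j) := by
          refine Finset.sum_le_sum fun l _ => ?_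
          exact mul_le_mul (ih l) (hAB _ _) (hA _ _) ((hB.pow n).1 _ _)
      _ = ∑ l ∈ Finset.univ.map ⟨f, hf⟩, (B ^ n) (f i) l * B l (f j) := by simp
      _ ≤ _ := Finset.sum_le_sum_of_subset_of_nonneg (Finset.subset_univ _)
          fun l _ _ => mul_nonneg ((hB.pow n).1 _ _) (hB.1 _ _)

/-- Positivity of the powers on a primitive diagonal block spreads to the whole block. -/
theorem LeftStochastic.eventuallyPos_of_block {α : Type*} [Fintype α] [DecidableEq α]
    {A : Matrix α α ℝ} {B : Matrix N N ℝ} (hB : LeftStochastic B) (hA : WithinTeam A) {f : α → N}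
    (hf : f.Injective) (hAB : ∀ i j, A i j ≤ B (f i) (f j)) (i j : α) :
    EventuallyPos B (f i) (f j) := by
  obtain ⟨n₀, hn⟩ := hA.eventuallyPos i j
  exact ⟨n₀, fun n h => (hn n h).trans_le (hB.le_pow_apply hA.2.1 hf hAB n i j)⟩

/-- Positivity of the powers spreads along an irreducible diagonal block. -/
theorem EventuallyPos.of_isIrreducible {β : Type*} {D : Matrix β β ℝ} {B : Matrix N N ℝ}
    (hB : LeftStochastic B) (hD : D.IsIrreducible) {g : β → N}
    (hDB : ∀ i j, D i j ≤ B (g i) (g j)) {r : N} {i : β} (h : EventuallyPos B r (g i)) (j : β) :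
    EventuallyPos B r (g j) := by
  let := D.toQuiver
  obtain ⟨w, -⟩ := hD.connected i j
  induction w with
  | nil => exact h
  | cons w e ih => exact ih.step hB (e.down.trans_le (hDB _ _))

end Matrices

/-! ### The block matrices that mix the copies of one team's strategy. -/

section Blocks

variable {K₁ K₂ : ℕ} {A₁ : Matrix (Fin K₁) (Fin K₁) ℝ} {A₂ : Matrix (Fin K₂) (Fin K₂) ℝ}
  {C : Matrix (Agent K₁ K₂) (Agent K₁ K₂) ℝ} {p : Agent K₁ K₂ → ℝ}

/-- The matrix that combines the copies of the strategy of Team 1 held by all agents. -/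
def mixX (A₁ : Matrix (Fin K₁) (Fin K₁) ℝ) (C : Matrix (Agent K₁ K₂) (Agent K₁ K₂) ℝ) :
    Matrix (Agent K₁ K₂) (Agent K₁ K₂) ℝ :=
  Matrix.fromBlocks A₁ (A₁ * C.toBlocks₁₂) 0 C.toBlocks₂₂

/-- The matrix that combines the copies of the strategy of Team 2 held by all agents. -/
def mixY (A₂ : Matrix (Fin K₂) (Fin K₂) ℝ) (C : Matrix (Agent K₁ K₂) (Agent K₁ K₂) ℝ) :
    Matrix (Agent K₁ K₂) (Agent K₁ K₂) ℝ :=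
  Matrix.fromBlocks C.toBlocks₁₁ 0 (A₂ * C.toBlocks₂₁) A₂

/-- The Perron weights of Team 1, extended by zero to all agents. -/
def weightX (p : Agent K₁ K₂ → ℝ) : Agent K₁ K₂ → ℝ := Sum.elim (fun k => p (Sum.inl k)) 0

/-- The Perron weights of Team 2, extended by zero to all agents. -/
def weightY (p : Agent K₁ K₂ → ℝ) : Agent K₁ K₂ → ℝ := Sum.elim 0 (fun k => p (Sum.inr k))

theorem StrongCrossTeam.leftStochastic (h : StrongCrossTeam C) : LeftStochastic C := by
  obtain ⟨h11, h22, h12, h21⟩ := h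
  have e11 : ∀ i j, C (Sum.inl i) (Sum.inl j) = 0 := fun i j => congrFun (congrFun h11 i) j
  have e22 : ∀ i j, C (Sum.inr i) (Sum.inr j) = 0 := fun i j => congrFun (congrFun h22 i) j
  refine ⟨?_, ?_⟩
  · rintro (i | i) (j | j)
    · rw [e11]
    · exact h12.1 i j
    · exact h21.1 i j
    · rw [e22]
  · rintro (j | j)
    · rw [Fintype.sum_sum_type]
      simpa [e11, Matrix.toBlocks₂₁] using h21.2 j
    · rw [Fintype.sum_sum_type]
      simpa [e22, Matrix.toBlocks₁₂] using h12.2 j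

theorem Method.CrossTeam.leftStochastic {m : Method} (h : m.CrossTeam C) : LeftStochastic C := by
  cases m
  · exact h.1
  · exact StrongCrossTeam.leftStochastic h

theorem leftStochastic_mixX (hA : LeftStochastic A₁) (hC : LeftStochastic C) :
    LeftStochastic (mixX A₁ C) := by
  have h := hA.mul (B := C.toBlocks₁₂) fun i j => hC.1 _ _
  refine ⟨?_, ?_⟩
  · rintro (i | i) (j | j)
    · exact hA.1 i j
    · exact h.1 i j
    · exact le_rfl
    · exact hC.1 _ _
  · rintro (j | j)
    · rw [Fintype.sum_sum_type]
      simpa [mixX] using hA.2 j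
    · rw [← hC.2 (Sum.inr j), Fintype.sum_sum_type, Fintype.sum_sum_type]
      simp only [mixX, Matrix.fromBlocks_apply₁₂, Matrix.fromBlocks_apply₂₂]
      exact congrArg (· + _) (h.2 j)

theorem leftStochastic_mixY (hA : LeftStochastic A₂) (hC : LeftStochastic C) :
    LeftStochastic (mixY A₂ C) := by
  have h := hA.mul (B := C.toBlocks₂₁) fun i j => hC.1 _ _
  refine ⟨?_, ?_⟩
  · rintro (i | i) (j | j)
    · exact hC.1 _ _
    · exact le_rfl
    · exact h.1 i j
    · exact hA.1 i j
  · rintro (j | j)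
    · rw [← hC.2 (Sum.inl j), Fintype.sum_sum_type, Fintype.sum_sum_type]
      simp only [mixY, Matrix.fromBlocks_apply₁₁, Matrix.fromBlocks_apply₂₁]
      exact congrArg (_ + ·) (h.2 j)
    · rw [Fintype.sum_sum_type]
      simpa [mixY] using hA.2 j

theorem mixX_mulVec_weightX (hp : IsPerronVector A₁ (fun k => p (Sum.inl k))) :
    (mixX A₁ C).mulVec (weightX p) = weightX p := by
  rw [mixX, Matrix.fromBlocks_mulVec, weightX]
  simp only [Sum.elim_comp_inl, Sum.elim_comp_inr, Matrix.mulVec_zero, hp.2.2, Matrix.zero_mulVec,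
    add_zero]

theorem mixY_mulVec_weightY (hp : IsPerronVector A₂ (fun k => p (Sum.inr k))) :
    (mixY A₂ C).mulVec (weightY p) = weightY p := by
  rw [mixY, Matrix.fromBlocks_mulVec, weightY]
  simp only [Sum.elim_comp_inl, Sum.elim_comp_inr, Matrix.mulVec_zero, hp.2.2, Matrix.zero_mulVec,
    add_zero, zero_add]

theorem sum_weightX (hp : IsPerronVector A₁ (fun k => p (Sum.inl k))) :
    ∑ k, weightX p k = 1 := by
  rw [Fintype.sum_sum_type]
  simpa [weightX] using hp.2.1

theorem sum_weightY (hp : IsPerronVector A₂ (fun k => p (Sum.inr k))) :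
    ∑ k, weightY p k = 1 := by
  rw [Fintype.sum_sum_type]
  simpa [weightY] using hp.2.1

theorem IsPerronVector.nonempty {n : Type*} [Fintype n] {A : Matrix n n ℝ} {q : n → ℝ}
    (h : IsPerronVector A q) : Nonempty n := by
  by_contra hn
  rw [not_nonempty_iff] at hn
  simpa using h.2.1

theorem LeftStochastic.exists_mul_pos {m n k : Type*} [Fintype m] [Fintype n] {A : Matrix m n ℝ}
    (hA : LeftStochastic A) {D : Matrix n k ℝ} (hD : ∀ i j, 0 ≤ D i j) {l : n} {j : k}
    (h : 0 < D l j) : ∃ r, 0 < (A * D) r j := by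
  obtain ⟨r, hr⟩ := hA.exists_pos l
  exact ⟨r, Finset.sum_pos' (fun i _ => mul_nonneg (hA.1 _ _) (hD _ _))
    ⟨l, Finset.mem_univ l, mul_pos hr h⟩⟩

/-- A row of Team 1 becomes positive. It is so on Team 1 by primitivity of `A₁`, and a link of `C`
carries this to Team 2. In ATC-ITC one link suffices, as `C₂₂` is irreducible; in ATC-C every column
of `C₁₂` has its own link. -/
theorem exists_sum_abs_mixX_pow_sub_le {m : Method} (hA : WithinTeam A₁)
    (hp : IsPerronVector A₁ (fun k => p (Sum.inl k))) (hC : m.CrossTeam C) :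
    ∃ S, 0 ≤ S ∧ ∀ n l k,
      ∑ i ∈ Finset.range n, |(mixX A₁ C ^ (i + 1)) l k - weightX p l| ≤ S := by
  have hCs := hC.leftStochastic
  have hB := leftStochastic_mixX hA.2 hCs
  refine hB.exists_sum_abs_pow_sub_le (sum_weightX hp) (mixX_mulVec_weightX hp) ?_
  obtain ⟨r⟩ := hp.nonempty
  have hl : ∀ j, EventuallyPos (mixX A₁ C) (Sum.inl r) (Sum.inl j) :=
    hB.eventuallyPos_of_block hA Sum.inl_injective (fun _ _ => le_rfl) r
  have hlink : ∀ l j, 0 < C (Sum.inl l) (Sum.inr j) →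
      EventuallyPos (mixX A₁ C) (Sum.inl r) (Sum.inr j) := by
    intro l j h
    obtain ⟨i, hi⟩ := hA.2.exists_mul_pos (D := C.toBlocks₁₂) (fun _ _ => hCs.1 _ _) h
    exact (hl i).step hB hi
  refine exists_forall_pow_pos (r := Sum.inl r) ?_
  rintro (j | j)
  · exact hl j
  · cases m with
    | atcItc =>
      obtain ⟨-, -, h22, -, j₀, l, h⟩ := hC
      exact EventuallyPos.of_isIrreducible hB h22 (g := Sum.inr) (fun _ _ => le_rfl)
        (hlink l j₀ h) j
    | atcC =>
      obtain ⟨-, -, h12, -⟩ := hC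
      obtain ⟨l, h⟩ := h12.exists_pos j
      exact hlink l j h

theorem exists_sum_abs_mixY_pow_sub_le {m : Method} (hA : WithinTeam A₂)
    (hp : IsPerronVector A₂ (fun k => p (Sum.inr k))) (hC : m.CrossTeam C) :
    ∃ S, 0 ≤ S ∧ ∀ n l k,
      ∑ i ∈ Finset.range n, |(mixY A₂ C ^ (i + 1)) l k - weightY p l| ≤ S := by
  have hCs := hC.leftStochastic
  have hB := leftStochastic_mixY hA.2 hCs
  refine hB.exists_sum_abs_pow_sub_le (sum_weightY hp) (mixY_mulVec_weightY hp) ?_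
  obtain ⟨r⟩ := hp.nonempty
  have hl : ∀ j, EventuallyPos (mixY A₂ C) (Sum.inr r) (Sum.inr j) :=
    hB.eventuallyPos_of_block hA Sum.inr_injective (fun _ _ => le_rfl) r
  have hlink : ∀ l j, 0 < C (Sum.inr l) (Sum.inl j) →
      EventuallyPos (mixY A₂ C) (Sum.inr r) (Sum.inl j) := by
    intro l j h
    obtain ⟨i, hi⟩ := hA.2.exists_mul_pos (D := C.toBlocks₂₁) (fun _ _ => hCs.1 _ _) h
    exact (hl i).step hB hi
  refine exists_forall_pow_pos (r := Sum.inr r) ?_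
  rintro (j | j)
  · cases m with
    | atcItc =>
      obtain ⟨-, h11, -, ⟨j₀, l, h⟩, -⟩ := hC
      exact EventuallyPos.of_isIrreducible hB h11 (g := Sum.inl) (fun _ _ => le_rfl)
        (hlink l j₀ h) j
    | atcC =>
      obtain ⟨-, -, -, h21⟩ := hC
      obtain ⟨l, h⟩ := h21.exists_pos j
      exact hlink l j h
  · exact hl j

end Blocks

theorem norm_sum_smul_le {V ι : Type*} [NormedAddCommGroup V] [NormedSpace ℝ V] [Fintype ι]
    {q : ι → ℝ} (hq : ∀ i, 0 ≤ q i) (hq1 : ∑ i, q i = 1) {v : ι → V} {c : ℝ} (hv : ∀ i, ‖v i‖ ≤ c) : ‖∑ i, q i • v i‖ ≤ c := by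
  calc ‖∑ i, q i • v i‖ ≤ ∑ i, q i * c := by
        refine norm_sum_le_of_le _ fun i _ => ?_
        rw [norm_smul, Real.norm_of_nonneg (hq i)]
        exact mul_le_mul_of_nonneg_left (hv i) (hq i)
    _ = c := by rw [← Finset.sum_mul, hq1, one_mul]

/-! ### Gradients and global minimizers. -/

section Gradients

variable {E : Type*} [NormedAddCommGroup E] [InnerProductSpace ℝ E] [CompleteSpace E]

theorem gradient_sum_mul {ι : Type*} (s : Finset ι) (w : ι → ℝ) {f : ι → E → ℝ} {x : E}
    (hf : ∀ i ∈ s, DifferentiableAt ℝ (f i) x) :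
    gradient (fun x' => ∑ i ∈ s, w i * f i x') x = ∑ i ∈ s, w i • gradient (f i) x := by
  refine HasGradientAt.gradient ?_
  rw [hasGradientAt_iff_hasFDerivAt, map_sum]
  refine HasFDerivAt.fun_sum fun i hi => ?_
  rw [map_smul]
  exact ((hf i hi).hasGradientAt.hasFDerivAt).const_mul (w i)

/-- A stationary point of a function with monotone gradient is a global minimizer. -/
theorem le_of_gradient_eq_zero_of_monotone {f : E → ℝ} (hf : Differentiable ℝ f)
    (hmono : ∀ x x', 0 ≤ inner ℝ (gradient f x - gradient f x') (x - x')) {x₀ : E}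
    (h₀ : gradient f x₀ = 0) (x : E) : f x₀ ≤ f x := by
  set φ : ℝ → ℝ := fun t => f (x₀ + t • (x - x₀)) with hφ
  have hderiv : ∀ t, HasDerivAt φ (inner ℝ (gradient f (x₀ + t • (x - x₀))) (x - x₀)) t := by
    intro t
    have h1 : HasDerivAt (fun t : ℝ => x₀ + t • (x - x₀)) (x - x₀) t := by
      simpa using ((hasDerivAt_id t).smul_const (x - x₀)).const_add x₀
    have h2 := (hf (x₀ + t • (x - x₀))).hasFDerivAt.comp_hasDerivAt t h1
    rwa [← inner_gradient_left (𝕜 := ℝ)] at h2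
  -- By the mean value theorem `f x - f x₀` is the derivative at some `t > 0`; monotonicity between
  -- `x₀ + t(x - x₀)` and `x₀` gives `t` times that derivative the right sign.
  obtain ⟨t, ht, hslope⟩ := exists_hasDerivAt_eq_slope φ _ (zero_lt_one' ℝ)
    (fun t _ => (hderiv t).continuousAt.continuousWithinAt) fun t _ => hderiv t
  have h3 := hmono (x₀ + t • (x - x₀)) x₀
  rw [h₀, sub_zero, add_sub_cancel_left, inner_smul_right] at h3
  have h4 := nonneg_of_mul_nonneg_right h3 ht.1
  rw [hslope] at h4
  simp only [hφ] at h4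
  simp at h4
  exact h4

theorem gradient_eq_zero_of_forall_le {f : E → ℝ} {x₀ : E} (h : ∀ x, f x₀ ≤ f x) :
    gradient f x₀ = 0 := by
  have : IsLocalMin f x₀ := Eventually.of_forall h
  simp [gradient, this.fderiv_eq_zero]

end Gradients

/-! ### The game operator and the Nash equilibrium. -/

section Game

variable {K₁ K₂ M₁ M₂ : ℕ} {p : Agent K₁ K₂ → ℝ} {J : Agent K₁ K₂ → Vec M₁ → Vec M₂ → ℝ}
  {Lf ν : ℝ}

theorem LipschitzGradients.differentiable_fst (h : LipschitzGradients J Lf) (k : Agent K₁ K₂)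
    (y : Vec M₂) : Differentiable ℝ (fun x => J k x y) :=
  (h k).1.comp (f := fun x : Vec M₁ => (x, y)) (by fun_prop)

theorem LipschitzGradients.differentiable_snd (h : LipschitzGradients J Lf) (k : Agent K₁ K₂)
    (x : Vec M₁) : Differentiable ℝ (fun y => J k x y) :=
  (h k).1.comp (f := fun y : Vec M₂ => (x, y)) (by fun_prop)

/-- No sign is assumed for `Lf`, `G`, `σ`; absolute values keep all later constants nonnegative. -/
theorem LipschitzGradients.norm_gradX_sub_le (h : LipschitzGradients J Lf) (k : Agent K₁ K₂)
    (x₁ x₂ : Vec M₁) (y₁ y₂ : Vec M₂) :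
    ‖gradX (J k) x₁ y₁ - gradX (J k) x₂ y₂‖ ≤ |Lf| * (‖x₁ - x₂‖ + ‖y₁ - y₂‖) :=
  ((h k).2 x₁ x₂ y₁ y₂).1.trans (mul_le_mul_of_nonneg_right (le_abs_self _) (by positivity))

theorem LipschitzGradients.norm_gradY_sub_le (h : LipschitzGradients J Lf) (k : Agent K₁ K₂)
    (x₁ x₂ : Vec M₁) (y₁ y₂ : Vec M₂) :
    ‖gradY (J k) x₁ y₁ - gradY (J k) x₂ y₂‖ ≤ |Lf| * (‖x₁ - x₂‖ + ‖y₁ - y₂‖) :=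
  ((h k).2 x₁ x₂ y₁ y₂).2.trans (mul_le_mul_of_nonneg_right (le_abs_self _) (by positivity))

theorem gradX_teamCost₁ (h : LipschitzGradients J Lf) (x : Vec M₁) (y : Vec M₂) :
    gradX (teamCost₁ p J) x y = ∑ k : Fin K₁, p (Sum.inl k) • gradX (J (Sum.inl k)) x y :=
  gradient_sum_mul _ (fun k : Fin K₁ => p (Sum.inl k))
    (f := fun (k : Fin K₁) x' => J (Sum.inl k) x' y) fun _ _ => h.differentiable_fst _ y x

theorem gradY_teamCost₂ (h : LipschitzGradients J Lf) (x : Vec M₁) (y : Vec M₂) :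
    gradY (teamCost₂ p J) x y = ∑ k : Fin K₂, p (Sum.inr k) • gradY (J (Sum.inr k)) x y :=
  gradient_sum_mul _ (fun k : Fin K₂ => p (Sum.inr k))
    (f := fun (k : Fin K₂) y' => J (Sum.inr k) x y') fun _ _ => h.differentiable_snd _ x y

theorem differentiable_teamCost₁ (h : LipschitzGradients J Lf) (y : Vec M₂) :
    Differentiable ℝ fun x => teamCost₁ p J x y :=
  Differentiable.fun_sum fun _ _ => (h.differentiable_fst _ y).const_mul _

theorem differentiable_teamCost₂ (h : LipschitzGradients J Lf) (x : Vec M₁) :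
    Differentiable ℝ fun y => teamCost₂ p J x y :=
  Differentiable.fun_sum fun _ _ => (h.differentiable_snd _ x).const_mul _

/-- This is what makes the local gradients of Team 2, with reversed sign, a proxy for the gradient
of Team 1. -/
theorem ZeroSum.gradX_teamCost₂ (h : ZeroSum p J) (x : Vec M₁) (y : Vec M₂) :
    gradX (teamCost₂ p J) x y = -gradX (teamCost₁ p J) x y := by
  have : (fun x' => teamCost₁ p J x' y) = fun x' => -teamCost₂ p J x' y := funext fun x' => h x' y
  simp [gradX, this, gradient, fderiv_fun_neg]

theorem ZeroSum.gradY_teamCost₁ (h : ZeroSum p J) (x : Vec M₁) (y : Vec M₂) :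
    gradY (teamCost₁ p J) x y = -gradY (teamCost₂ p J) x y := by
  have : (fun y' => teamCost₁ p J x y') = fun y' => -teamCost₂ p J x y' := funext fun y' => h x y'
  simp [gradY, this, gradient, fderiv_fun_neg]

theorem norm_gradX_teamCost₁_sub_le (hL : LipschitzGradients J Lf)
    (hp : ∀ k : Fin K₁, 0 ≤ p (Sum.inl k)) (hp1 : ∑ k : Fin K₁, p (Sum.inl k) = 1)
    (x₁ x₂ : Vec M₁) (y₁ y₂ : Vec M₂) :
    ‖gradX (teamCost₁ p J) x₁ y₁ - gradX (teamCost₁ p J) x₂ y₂‖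
      ≤ |Lf| * (‖x₁ - x₂‖ + ‖y₁ - y₂‖) := by
  rw [gradX_teamCost₁ hL, gradX_teamCost₁ hL, ← Finset.sum_sub_distrib]
  simp only [← smul_sub]
  exact norm_sum_smul_le hp hp1 fun _ => hL.norm_gradX_sub_le _ _ _ _ _

theorem norm_gradY_teamCost₂_sub_le (hL : LipschitzGradients J Lf)
    (hp : ∀ k : Fin K₂, 0 ≤ p (Sum.inr k)) (hp1 : ∑ k : Fin K₂, p (Sum.inr k) = 1)
    (x₁ x₂ : Vec M₁) (y₁ y₂ : Vec M₂) :
    ‖gradY (teamCost₂ p J) x₁ y₁ - gradY (teamCost₂ p J) x₂ y₂‖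
      ≤ |Lf| * (‖x₁ - x₂‖ + ‖y₁ - y₂‖) := by
  rw [gradY_teamCost₂ hL, gradY_teamCost₂ hL, ← Finset.sum_sub_distrib]
  simp only [← smul_sub]
  exact norm_sum_smul_le hp hp1 fun _ => hL.norm_gradY_sub_le _ _ _ _ _

theorem Joint.norm_sq_eq (z : Joint M₁ M₂) : ‖z‖ ^ 2 = ‖z.fst‖ ^ 2 + ‖z.snd‖ ^ 2 :=
  WithLp.prod_norm_sq_eq_of_L2 z

/-- Each of the two blocks contributes `Lf² (a + b)² ≤ 2 Lf² (a² + b²)`, whence the factor 4. -/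
theorem norm_gameOperator_sub_sq_le (hL : LipschitzGradients J Lf)
    (hp₁ : ∀ k : Fin K₁, 0 ≤ p (Sum.inl k)) (hs₁ : ∑ k : Fin K₁, p (Sum.inl k) = 1)
    (hp₂ : ∀ k : Fin K₂, 0 ≤ p (Sum.inr k)) (hs₂ : ∑ k : Fin K₂, p (Sum.inr k) = 1)
    (z₁ z₂ : Joint M₁ M₂) :
    ‖gameOperator p J z₁ - gameOperator p J z₂‖ ^ 2 ≤ 4 * Lf ^ 2 * ‖z₁ - z₂‖ ^ 2 := by
  have hx := norm_gradX_teamCost₁_sub_le hL hp₁ hs₁ z₁.fst z₂.fst z₁.snd z₂.snd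
  have hy := norm_gradY_teamCost₂_sub_le hL hp₂ hs₂ z₁.fst z₂.fst z₁.snd z₂.snd
  have hx2 := pow_le_pow_left₀ (norm_nonneg _) hx 2
  have hy2 := pow_le_pow_left₀ (norm_nonneg _) hy 2
  rw [mul_pow, sq_abs] at hx2 hy2
  have hsum : (‖z₁.fst - z₂.fst‖ + ‖z₁.snd - z₂.snd‖) ^ 2 ≤ 2 * ‖z₁ - z₂‖ ^ 2 := by
    rw [Joint.norm_sq_eq, WithLp.sub_fst, WithLp.sub_snd]
    nlinarith [sq_nonneg (‖z₁.fst - z₂.fst‖ - ‖z₁.snd - z₂.snd‖)]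
  rw [Joint.norm_sq_eq]
  calc _ ≤ Lf ^ 2 * (‖z₁.fst - z₂.fst‖ + ‖z₁.snd - z₂.snd‖) ^ 2
        + Lf ^ 2 * (‖z₁.fst - z₂.fst‖ + ‖z₁.snd - z₂.snd‖) ^ 2 := add_le_add hx2 hy2
    _ ≤ _ := by nlinarith [mul_le_mul_of_nonneg_left hsum (sq_nonneg Lf)]

/-- Expand the square: monotonicity bounds the cross term, the Lipschitz bound the last one. It
serves both the existence of a zero and the mean-square recursion. -/
theorem norm_sub_smul_gameOperator_sq_le (hL : LipschitzGradients J Lf)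
    (hp₁ : ∀ k : Fin K₁, 0 ≤ p (Sum.inl k)) (hs₁ : ∑ k : Fin K₁, p (Sum.inl k) = 1)
    (hp₂ : ∀ k : Fin K₂, 0 ≤ p (Sum.inr k)) (hs₂ : ∑ k : Fin K₂, p (Sum.inr k) = 1)
    (hν : StronglyMonotone p J ν) {μ : ℝ} (hμ : 0 ≤ μ) (z₁ z₂ : Joint M₁ M₂) :
    ‖(z₁ - μ • gameOperator p J z₁) - (z₂ - μ • gameOperator p J z₂)‖ ^ 2
      ≤ (1 - 2 * μ * ν + μ ^ 2 * (4 * Lf ^ 2)) * ‖z₁ - z₂‖ ^ 2 := by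
  have h1 := norm_gameOperator_sub_sq_le hL hp₁ hs₁ hp₂ hs₂ z₁ z₂
  have h2 := hν z₁ z₂
  have h3 : (z₁ - μ • gameOperator p J z₁) - (z₂ - μ • gameOperator p J z₂)
      = (z₁ - z₂) - μ • (gameOperator p J z₁ - gameOperator p J z₂) := by module
  rw [h3, norm_sub_sq_real, inner_smul_right, real_inner_comm, norm_smul, mul_pow,
    Real.norm_eq_abs, sq_abs]
  nlinarith [mul_le_mul_of_nonneg_left h1 (sq_nonneg μ), mul_le_mul_of_nonneg_left h2 hμ]

theorem StronglyMonotone.eq_of_gameOperator_eq_zero (hν : StronglyMonotone p J ν) (h : 0 < ν)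
    {z₁ z₂ : Joint M₁ M₂} (h₁ : gameOperator p J z₁ = 0) (h₂ : gameOperator p J z₂ = 0) :
    z₁ = z₂ := by
  have := hν z₁ z₂
  rw [h₁, h₂, sub_zero, inner_zero_left] at this
  have h3 : ‖z₁ - z₂‖ ^ 2 ≤ 0 := by
    by_contra! h4
    linarith [mul_pos h h4]
  rw [← sub_eq_zero, ← norm_eq_zero]
  exact pow_eq_zero_iff two_ne_zero |>.1 (le_antisymm h3 (sq_nonneg _))

theorem exists_gameOperator_eq_zero (hL : LipschitzGradients J Lf)
    (hp₁ : ∀ k : Fin K₁, 0 ≤ p (Sum.inl k)) (hs₁ : ∑ k : Fin K₁, p (Sum.inl k) = 1)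
    (hp₂ : ∀ k : Fin K₂, 0 ≤ p (Sum.inr k)) (hs₂ : ∑ k : Fin K₂, p (Sum.inr k) = 1)
    (hν : StronglyMonotone p J ν) (h : 0 < ν) : ∃ z, gameOperator p J z = 0 := by
  -- The summand `ν²` keeps the denominator positive when `Lf = 0`; it costs only the favourable
  -- term `-(μν)²`.
  set μ := ν / (4 * Lf ^ 2 + ν ^ 2) with hμ
  have hden : 0 < 4 * Lf ^ 2 + ν ^ 2 := by positivity
  have hμ0 : 0 < μ := div_pos h hden
  have hμ1 : μ * (4 * Lf ^ 2 + ν ^ 2) = ν := div_mul_cancel₀ _ hden.ne'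
  have hμν : 0 < μ * ν := mul_pos hμ0 h
  have hfac : 1 - 2 * μ * ν + μ ^ 2 * (4 * Lf ^ 2) ≤ 1 - μ * ν := by
    have : μ * (μ * (4 * Lf ^ 2 + ν ^ 2)) = μ * ν := by rw [hμ1]
    nlinarith [sq_nonneg (μ * ν)]
  have hk : √(1 - μ * ν) < 1 := by
    rw [Real.sqrt_lt' one_pos]; linarith
  have hcontr : ContractingWith (Real.toNNReal √(1 - μ * ν))
      fun z : Joint M₁ M₂ => z - μ • gameOperator p J z := by
    refine ⟨by rwa [← NNReal.coe_lt_coe, Real.coe_toNNReal _ (Real.sqrt_nonneg _)], ?_⟩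
    refine LipschitzWith.of_dist_le_mul fun z₁ z₂ => ?_
    rw [Real.coe_toNNReal _ (Real.sqrt_nonneg _), dist_eq_norm, dist_eq_norm]
    have h1 := (norm_sub_smul_gameOperator_sq_le hL hp₁ hs₁ hp₂ hs₂ hν hμ0.le z₁ z₂).trans
      (mul_le_mul_of_nonneg_right hfac (sq_nonneg _))
    have h2 := Real.sqrt_le_sqrt h1
    rwa [Real.sqrt_sq (norm_nonneg _), Real.sqrt_mul' _ (sq_nonneg _),
      Real.sqrt_sq (norm_nonneg _)] at h2
  refine ⟨hcontr.fixedPoint, ?_⟩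
  have hfix := hcontr.fixedPoint_isFixedPt
  rw [Function.IsFixedPt, sub_eq_self] at hfix
  exact (smul_eq_zero.1 hfix).resolve_left hμ0.ne'

theorem IsNash.gameOperator_eq_zero {z : Joint M₁ M₂} (h : IsNash p J z) :
    gameOperator p J z = 0 := by
  have hx : gradX (teamCost₁ p J) z.fst z.snd = 0 := gradient_eq_zero_of_forall_le h.1
  have hy : gradY (teamCost₂ p J) z.fst z.snd = 0 := gradient_eq_zero_of_forall_le h.2
  rw [gameOperator, hx, hy]
  rfl

/-- With the opponent's strategy fixed, monotonicity of `F` restricts to monotonicity of a team's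
own partial gradient, so stationarity means global minimality. -/
theorem StronglyMonotone.isNash_of_gameOperator_eq_zero (hL : LipschitzGradients J Lf)
    (hν : StronglyMonotone p J ν) (h : 0 < ν) {z : Joint M₁ M₂} (hz : gameOperator p J z = 0) :
    IsNash p J z := by
  have hx : gradX (teamCost₁ p J) z.fst z.snd = 0 := congrArg WithLp.fst hz
  have hy : gradY (teamCost₂ p J) z.fst z.snd = 0 := congrArg WithLp.snd hz
  refine ⟨le_of_gradient_eq_zero_of_monotone (differentiable_teamCost₁ hL z.snd) ?_ hx,
    le_of_gradient_eq_zero_of_monotone (differentiable_teamCost₂ hL z.fst) ?_ hy⟩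
  · intro x x'
    have h1 := hν (col x z.snd) (col x' z.snd)
    rw [WithLp.prod_inner_apply] at h1
    have h2 : (0 : ℝ) ≤ ν * ‖col x z.snd - col x' z.snd‖ ^ 2 := by positivity
    have h3 := h2.trans h1
    simpa [col, gameOperator, gradX, gradY] using h3
  · intro y y'
    have h1 := hν (col z.fst y) (col z.fst y')
    rw [WithLp.prod_inner_apply] at h1
    have h2 : (0 : ℝ) ≤ ν * ‖col z.fst y - col z.fst y'‖ ^ 2 := by positivity
    have h3 := h2.trans h1
    simpa [col, gameOperator, gradX, gradY] using h3

end Game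

/-! ### Square-integrable functions and orthogonality. -/

section SecondMoments

variable {Ω : Type*} [mΩ : MeasurableSpace Ω] {P : Measure Ω} {E E' : Type*} [NormedAddCommGroup E]
  [NormedSpace ℝ E] [NormedAddCommGroup E']

/-- The function `f` is square integrable with `L²` norm at most `M`. -/
def L2Le (P : Measure Ω) (f : Ω → E') (M : ℝ) : Prop := MemLp f 2 P ∧ lpNorm f 2 P ≤ M

theorem L2Le.mono {f : Ω → E'} {M M' : ℝ} (h : L2Le P f M) (hM : M ≤ M') : L2Le P f M' :=
  ⟨h.1, h.2.trans hM⟩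

theorem L2Le.add {f g : Ω → E'} {M M' : ℝ} (hf : L2Le P f M) (hg : L2Le P g M') :
    L2Le P (fun ω => f ω + g ω) (M + M') :=
  ⟨hf.1.add hg.1, (lpNorm_add_le hf.1 one_le_two).trans (add_le_add hf.2 hg.2)⟩

theorem L2Le.smul {f : Ω → E} {M : ℝ} (hf : L2Le P f M) (c : ℝ) :
    L2Le P (fun ω => c • f ω) (|c| * M) := by
  refine ⟨hf.1.const_smul c, (lpNorm_const_smul c f P).trans_le ?_⟩
  simpa using mul_le_mul_of_nonneg_left hf.2 (abs_nonneg c)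

theorem L2Le.sum {ι : Type*} {t : Finset ι} {f : ι → Ω → E'} {M : ι → ℝ}
    (hf : ∀ i ∈ t, L2Le P (f i) (M i)) : L2Le P (fun ω => ∑ i ∈ t, f i ω) (∑ i ∈ t, M i) := by
  have h : (fun ω => ∑ i ∈ t, f i ω) = ∑ i ∈ t, f i := by ext ω; simp
  rw [h]
  exact ⟨memLp_finsetSum' _ fun i hi => (hf i hi).1,
    (lpNorm_sum_le (fun i hi => (hf i hi).1) one_le_two).trans
      (Finset.sum_le_sum fun i hi => (hf i hi).2)⟩

theorem L2Le.norm {f : Ω → E'} {M : ℝ} (hf : L2Le P f M) : L2Le P (fun ω => ‖f ω‖) M :=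
  ⟨hf.1.norm, (lpNorm_norm hf.1.1 2).trans_le hf.2⟩

theorem L2Le.of_norm_le {f : Ω → E'} {g : Ω → ℝ} {M : ℝ} (hg : L2Le P g M)
    (hf : AEStronglyMeasurable f P) (h : ∀ ω, ‖f ω‖ ≤ g ω) : L2Le P f M :=
  ⟨hg.1.mono' hf (Eventually.of_forall h), (lpNorm_mono_real hg.1 h).trans hg.2⟩

theorem l2Le_const [IsProbabilityMeasure P] (c : ℝ) : L2Le P (fun _ => c) |c| := by
  refine ⟨memLp_const c, ?_⟩
  simp [lpNorm_const']

theorem lpNorm_two_sq {f : Ω → E'} (hf : AEStronglyMeasurable f P) :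
    lpNorm f 2 P ^ 2 = ∫ ω, ‖f ω‖ ^ 2 ∂P := by
  have h0 : 0 ≤ ∫ ω, ‖f ω‖ ^ 2 ∂P := integral_nonneg fun ω => sq_nonneg _
  rw [lpNorm_eq_integral_norm_rpow_toReal two_ne_zero ENNReal.ofNat_ne_top hf]
  simp only [ENNReal.toReal_ofNat, Real.rpow_ofNat]
  rw [← Real.rpow_natCast, ← Real.rpow_mul h0]
  norm_num

theorem L2Le.integrable_sq {f : Ω → E'} {M : ℝ} (hf : L2Le P f M) :
    Integrable (fun ω => ‖f ω‖ ^ 2) P :=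
  (memLp_two_iff_integrable_sq_norm hf.1.1).1 hf.1

theorem L2Le.integral_sq_le {f : Ω → E'} {M : ℝ} (hf : L2Le P f M) :
    ∫ ω, ‖f ω‖ ^ 2 ∂P ≤ M ^ 2 := by
  rw [← lpNorm_two_sq hf.1.1]
  exact pow_le_pow_left₀ lpNorm_nonneg hf.2 2

theorem l2Le_of_integral_sq_le {f : Ω → E'} {M : ℝ} (hf : AEStronglyMeasurable f P)
    (hi : Integrable (fun ω => ‖f ω‖ ^ 2) P) (h : ∫ ω, ‖f ω‖ ^ 2 ∂P ≤ M ^ 2) : L2Le P f |M| := by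
  refine ⟨(memLp_two_iff_integrable_sq_norm hf).2 hi, ?_⟩
  rw [← abs_of_nonneg (lpNorm_nonneg (f := f)), ← sq_le_sq, lpNorm_two_sq hf]
  exact h

theorem integrable_inner_of_memLp_two {V : Type*} [NormedAddCommGroup V] [InnerProductSpace ℝ V]
    {f g : Ω → V} (hf : MemLp f 2 P) (hg : MemLp g 2 P) :
    Integrable (fun ω => inner ℝ (f ω) (g ω)) P :=
  (hf.norm.integrable_mul hg.norm).mono' (hf.1.inner hg.1)
    (Eventually.of_forall fun _ => norm_inner_le_norm _ _)

/-- The `m`-measurable factor is pulled out of the conditional expectation of the inner product. -/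
theorem integral_inner_eq_zero_of_condExp_eq_zero {Ω : Type*} {m mΩ : MeasurableSpace Ω}
    {P : Measure Ω} {V : Type*} [NormedAddCommGroup V]
    [InnerProductSpace ℝ V] [CompleteSpace V] [IsFiniteMeasure P]
    (hm : m ≤ mΩ) {f g : Ω → V} (hf : StronglyMeasurable[m] f)
    (hf2 : MemLp f 2 P) (hg2 : MemLp g 2 P) (hg : P[g | m] =ᵐ[P] 0) :
    ∫ ω, inner ℝ (f ω) (g ω) ∂P = 0 := by
  have hint := integrable_inner_of_memLp_two hf2 hg2
  have h := condExp_bilin_of_stronglyMeasurable_left (innerSL ℝ) hf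
    hint (hg2.integrable one_le_two)
  rw [← integral_condExp hm]
  refine integral_eq_zero_of_ae ?_
  filter_upwards [h, hg] with ω h1 h2
  exact h1.trans (by simp [h2])

end SecondMoments

/-! ### Linear recursions driven by a mixing matrix. -/

section Mixing

theorem sum_weighted_step {N V : Type*} [Fintype N] [AddCommGroup V] [Module ℝ V]
    {B : Matrix N N ℝ} {q : N → ℝ} (hBq : B.mulVec q = q) (y : N → V) :
    ∑ k, q k • ∑ l, B l k • y l = ∑ l, q l • y l := by
  simp only [Finset.smul_sum]
  rw [Finset.sum_comm]
  refine Finset.sum_congr rfl fun l _ => ?_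
  conv_rhs => rw [← hBq]
  simp only [Matrix.mulVec, dotProduct, Finset.sum_smul, smul_smul, mul_comm]

variable {N V : Type*} [Fintype N] [DecidableEq N] [NormedAddCommGroup V] [NormedSpace ℝ V]

/-- Variation of constants. An input is combined already in the step in which it enters, so only
exponents `i - j ≥ 1` occur. -/
theorem eq_sum_pow_smul_of_step {B : Matrix N N ℝ} {x w : ℕ → N → V} (h0 : ∀ k, x 0 k = 0)
    (hstep : ∀ i k, x (i + 1) k = ∑ l, B l k • (x i l + w i l)) (i : ℕ) (k : N) :
    x i k = ∑ j ∈ Finset.range i, ∑ l, (B ^ (i - j)) l k • w j l := by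
  induction i generalizing k with
  | zero => simpa using h0 k
  | succ i ih =>
    rw [hstep, Finset.sum_range_succ]
    simp only [smul_add, Finset.sum_add_distrib, Nat.add_sub_cancel_left, pow_one]
    congr 1
    calc ∑ l, B l k • x i l
        = ∑ l, ∑ j ∈ Finset.range i, ∑ l', ((B ^ (i - j)) l' l * B l k) • w j l' := by
          refine Finset.sum_congr rfl fun l _ => ?_
          rw [ih, Finset.smul_sum]
          refine Finset.sum_congr rfl fun j _ => ?_
          rw [Finset.smul_sum]
          refine Finset.sum_congr rfl fun l' _ => ?_
          rw [smul_smul, mul_comm]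
      _ = _ := by
          rw [Finset.sum_comm]
          refine Finset.sum_congr rfl fun j hj => ?_
          rw [Finset.sum_comm]
          refine Finset.sum_congr rfl fun l' _ => ?_
          rw [← Finset.sum_smul, Nat.succ_sub (Finset.mem_range.1 hj).le, pow_succ,
            Matrix.mul_apply]

/-- The coefficients `(B ^ (i - j)) l k - q l` sum to zero over `l`, so the common drift `v`
disappears, however large it is. -/
theorem sub_weighted_eq_sum_of_step {B : Matrix N N ℝ} {q : N → ℝ} (hB : LeftStochastic B)
    (hq : ∑ l, q l = 1) (hBq : B.mulVec q = q) {x e : ℕ → N → V} {v : ℕ → V} {μ : ℝ}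
    (h0 : ∀ k, x 0 k = 0)
    (hstep : ∀ i k, x (i + 1) k = ∑ l, B l k • (x i l + μ • (v i + e i l))) (i : ℕ) (k : N) :
    x i k - ∑ l, q l • x i l
      = ∑ j ∈ Finset.range i, ∑ l, ((B ^ (i - j)) l k - q l) • (μ • e j l) := by
  have hx := eq_sum_pow_smul_of_step h0 hstep i
  have hmean : ∑ l, q l • x i l
      = ∑ j ∈ Finset.range i, ∑ l, q l • (μ • (v j + e j l)) := by
    simp only [hx, Finset.smul_sum]
    rw [Finset.sum_comm]
    refine Finset.sum_congr rfl fun j _ => ?_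
    rw [Finset.sum_comm]
    refine Finset.sum_congr rfl fun l _ => ?_
    have h1 := congrFun (mulVec_pow_eq_self hBq (i - j)) l
    simp only [Matrix.mulVec, dotProduct] at h1
    rw [← h1, Finset.sum_smul]
    refine Finset.sum_congr rfl fun l' _ => ?_
    rw [smul_smul, mul_comm]
  rw [hmean, hx, ← Finset.sum_sub_distrib]
  refine Finset.sum_congr rfl fun j _ => ?_
  rw [← Finset.sum_sub_distrib]
  simp only [← sub_smul]
  simp only [smul_add, Finset.sum_add_distrib]
  rw [← Finset.sum_smul, Finset.sum_sub_distrib, (hB.pow _).2, hq, sub_self, zero_smul, zero_add]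

variable {Ω : Type*} [MeasurableSpace Ω] {P : Measure Ω}

/-- Copies that start from zero and are combined by a fast mixing matrix stay within `O(μ)` of
their weighted average, whatever the common drift. -/
theorem l2Le_sub_weighted_of_step {B : Matrix N N ℝ} {q : N → ℝ} (hB : LeftStochastic B)
    (hq : ∑ l, q l = 1) (hBq : B.mulVec q = q) {S : ℝ}
    (hS : ∀ n l k, ∑ i ∈ Finset.range n, |(B ^ (i + 1)) l k - q l| ≤ S)
    {x e : ℕ → N → Ω → V} {v : ℕ → Ω → V} {μ R : ℝ} (hμ : 0 ≤ μ) (hR : 0 ≤ R)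
    (h0 : ∀ k ω, x 0 k ω = 0)
    (hstep : ∀ i k ω, x (i + 1) k ω = ∑ l, B l k • (x i l ω + μ • (v i ω + e i l ω)))
    (i : ℕ) (he : ∀ j < i, ∀ l, L2Le P (e j l) R) (k : N) :
    L2Le P (fun ω => x i k ω - ∑ l, q l • x i l ω) (μ * (Fintype.card N * S) * R) := by
  have heq : (fun ω => x i k ω - ∑ l, q l • x i l ω) = fun ω =>
      ∑ j ∈ Finset.range i, ∑ l, ((B ^ (i - j)) l k - q l) • (μ • e j l ω) := by
    funext ω
    exact sub_weighted_eq_sum_of_step hB hq hBq (x := fun i k => x i k ω)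
      (e := fun i k => e i k ω) (v := fun i => v i ω) (fun k => h0 k ω)
      (fun i k => hstep i k ω) i k
  rw [heq]
  refine (L2Le.sum fun j hj => L2Le.sum fun l _ =>
    ((he j (Finset.mem_range.1 hj) l).smul μ).smul ((B ^ (i - j)) l k - q l)).mono ?_
  rw [Finset.sum_comm, abs_of_nonneg hμ]
  calc ∑ l, ∑ j ∈ Finset.range i, |(B ^ (i - j)) l k - q l| * (μ * R)
      = ∑ l, (∑ j ∈ Finset.range i, |(B ^ (j + 1)) l k - q l|) * (μ * R) := by
        refine Finset.sum_congr rfl fun l _ => ?_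
        -- Time reversal `j ↦ i - 1 - j` turns the exponent `i - j` into `j + 1`, the form summed in
        -- `hS`; the bound is therefore uniform in `i`.
        rw [← Finset.sum_mul, ← Finset.sum_range_reflect]
        congr 1
        refine Finset.sum_congr rfl fun j hj => ?_
        rw [show i - (i - 1 - j) = j + 1 by have := Finset.mem_range.1 hj; omega]
    _ ≤ ∑ _l : N, S * (μ * R) :=
        Finset.sum_le_sum fun l _ => mul_le_mul_of_nonneg_right (hS i l k) (by positivity)
    _ = _ := by
        rw [Finset.sum_const, Finset.card_univ, nsmul_eq_mul]; ring

end Mixing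

/-! ### The algorithms as linear recursions; measurability and moments of the iterates. -/

section Dynamics

variable {K₁ K₂ M₁ M₂ : ℕ} {p : Agent K₁ K₂ → ℝ} {J : Agent K₁ K₂ → Vec M₁ → Vec M₂ → ℝ}
  {Lf ν G σ : ℝ} {A₁ : Matrix (Fin K₁) (Fin K₁) ℝ} {A₂ : Matrix (Fin K₂) (Fin K₂) ℝ}
  {C : Matrix (Agent K₁ K₂) (Agent K₁ K₂) ℝ} {m : Method} {μ : ℝ}

/-- The directions along which all agents move their copies of the strategy of Team 1. -/
def driveX (g : Agent K₁ K₂ → Vec M₁ → Vec M₂ → Vec M₁) (s : State K₁ K₂ M₁ M₂) :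
    Agent K₁ K₂ → Vec M₁
  | Sum.inl l => -g (Sum.inl l) (s (Sum.inl l)).1 (s (Sum.inl l)).2
  | Sum.inr l => g (Sum.inr l) (s (Sum.inr l)).1 (s (Sum.inr l)).2

/-- The directions along which all agents move their copies of the strategy of Team 2. -/
def driveY (g : Agent K₁ K₂ → Vec M₁ → Vec M₂ → Vec M₂) (s : State K₁ K₂ M₁ M₂) :
    Agent K₁ K₂ → Vec M₂
  | Sum.inl l => g (Sum.inl l) (s (Sum.inl l)).1 (s (Sum.inl l)).2
  | Sum.inr l => -g (Sum.inr l) (s (Sum.inr l)).1 (s (Sum.inr l)).2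

theorem sum_smul_sum_smul {m n k V : Type*} [Fintype m] [Fintype n] [AddCommGroup V] [Module ℝ V]
    (A : Matrix m n ℝ) (D : Matrix n k ℝ) (v : m → V) (j : k) :
    ∑ l, D l j • ∑ i, A i l • v i = ∑ i, (A * D) i j • v i := by
  simp only [Finset.smul_sum, Matrix.mul_apply, Finset.sum_smul, smul_smul]
  rw [Finset.sum_comm]
  simp only [mul_comm]

/-- Team 2 averages strategies that Team 1 has already combined, hence the block `A₁ * C₁₂`. The
same formula covers ATC-C because there `C₂₂ = 0`. -/
theorem Method.step_fst (hC : m.CrossTeam C) (gx : Agent K₁ K₂ → Vec M₁ → Vec M₂ → Vec M₁)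
    (gy : Agent K₁ K₂ → Vec M₁ → Vec M₂ → Vec M₂) (s : State K₁ K₂ M₁ M₂) (k : Agent K₁ K₂) :
    (Method.step A₁ A₂ C μ gx gy s m k).1
      = ∑ l, mixX A₁ C l k • ((s l).1 + μ • driveX gx s l) := by
  rw [Fintype.sum_sum_type]
  rcases k with k | k
  · cases m <;> simp [Method.step, ownX, mixX, driveX, sub_eq_add_neg]
  · have h := sum_smul_sum_smul A₁ C.toBlocks₁₂
      (fun l => (s (Sum.inl l)).1 + μ • driveX gx s (Sum.inl l)) k
    have hown : ∀ l, ownX A₁ μ gx s l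
        = ∑ i, A₁ i l • ((s (Sum.inl i)).1 + μ • driveX gx s (Sum.inl i)) := by
      intro l
      simp [ownX, driveX, sub_eq_add_neg]
    simp only [mixX, Matrix.fromBlocks_apply₁₂, Matrix.fromBlocks_apply₂₂, ← h]
    cases m with
    | atcItc => simp only [Method.step, hown]; rfl
    | atcC =>
      have h22 : C.toBlocks₂₂ = 0 := hC.2.1
      simp only [Method.step, hown, h22, Matrix.zero_apply, zero_smul, Finset.sum_const_zero,
        add_zero]
      rfl

theorem Method.step_snd (hC : m.CrossTeam C) (gx : Agent K₁ K₂ → Vec M₁ → Vec M₂ → Vec M₁)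
    (gy : Agent K₁ K₂ → Vec M₁ → Vec M₂ → Vec M₂) (s : State K₁ K₂ M₁ M₂) (k : Agent K₁ K₂) :
    (Method.step A₁ A₂ C μ gx gy s m k).2
      = ∑ l, mixY A₂ C l k • ((s l).2 + μ • driveY gy s l) := by
  rw [Fintype.sum_sum_type]
  rcases k with k | k
  · have h := sum_smul_sum_smul A₂ C.toBlocks₂₁
      (fun l => (s (Sum.inr l)).2 + μ • driveY gy s (Sum.inr l)) k
    have hown : ∀ l, ownY A₂ μ gy s l
        = ∑ i, A₂ i l • ((s (Sum.inr i)).2 + μ • driveY gy s (Sum.inr i)) := by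
      intro l
      simp [ownY, driveY, sub_eq_add_neg]
    simp only [mixY, Matrix.fromBlocks_apply₁₁, Matrix.fromBlocks_apply₂₁, ← h]
    cases m with
    | atcItc => simp only [Method.step, hown]; exact add_comm _ _
    | atcC =>
      have h11 : C.toBlocks₁₁ = 0 := hC.1
      simp only [Method.step, hown, h11, Matrix.zero_apply, zero_smul, Finset.sum_const_zero,
        zero_add]
      rfl
  · cases m <;> simp [Method.step, ownY, mixY, driveY, sub_eq_add_neg]

theorem centroid_fst (s : State K₁ K₂ M₁ M₂) :
    (centroid p s).fst = ∑ k, weightX p k • (s k).1 := by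
  simp [centroid, col, weightX, Fintype.sum_sum_type]

theorem centroid_snd (s : State K₁ K₂ M₁ M₂) :
    (centroid p s).snd = ∑ k, weightY p k • (s k).2 := by
  simp [centroid, col, weightY, Fintype.sum_sum_type]

/-- The field `g` averaged over each team with the Perron weights. -/
def teamAverage (p : Agent K₁ K₂ → ℝ) (gx : Agent K₁ K₂ → Vec M₁) (gy : Agent K₁ K₂ → Vec M₂) :
    Joint M₁ M₂ :=
  col (∑ k : Fin K₁, p (Sum.inl k) • gx (Sum.inl k)) (∑ k : Fin K₂, p (Sum.inr k) • gy (Sum.inr k))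

theorem teamAverage_sub (gx hx : Agent K₁ K₂ → Vec M₁) (gy hy : Agent K₁ K₂ → Vec M₂) :
    teamAverage p gx gy - teamAverage p hx hy
      = teamAverage p (fun k => gx k - hx k) (fun k => gy k - hy k) := by
  simp [teamAverage, col, smul_sub, Finset.sum_sub_distrib, ← WithLp.toLp_sub]

/-- Combining preserves the weighted average, and estimates have weight zero, so only the gradients
of a team's own agents move its block. -/
theorem centroid_step (hp₁ : IsPerronVector A₁ (fun k => p (Sum.inl k)))
    (hp₂ : IsPerronVector A₂ (fun k => p (Sum.inr k))) (hC : m.CrossTeam C)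
    (gx : Agent K₁ K₂ → Vec M₁ → Vec M₂ → Vec M₁)
    (gy : Agent K₁ K₂ → Vec M₁ → Vec M₂ → Vec M₂) (s : State K₁ K₂ M₁ M₂) :
    centroid p (Method.step A₁ A₂ C μ gx gy s m) = centroid p s -
      μ • teamAverage p (fun k => gx k (s k).1 (s k).2) (fun k => gy k (s k).1 (s k).2) := by
  have hx : (centroid p (Method.step A₁ A₂ C μ gx gy s m)).fst = (centroid p s).fst -
      μ • ∑ k : Fin K₁, p (Sum.inl k) • gx (Sum.inl k) (s (Sum.inl k)).1 (s (Sum.inl k)).2 := by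
    rw [centroid_fst, centroid_fst]
    simp only [Method.step_fst hC]
    rw [sum_weighted_step (mixX_mulVec_weightX hp₁)]
    simp only [smul_add, Finset.sum_add_distrib]
    rw [sub_eq_add_neg]
    congr 1
    simp [weightX, driveX, Fintype.sum_sum_type, Finset.smul_sum, smul_comm μ]
  have hy : (centroid p (Method.step A₁ A₂ C μ gx gy s m)).snd = (centroid p s).snd -
      μ • ∑ k : Fin K₂, p (Sum.inr k) • gy (Sum.inr k) (s (Sum.inr k)).1 (s (Sum.inr k)).2 := by
    rw [centroid_snd, centroid_snd]
    simp only [Method.step_snd hC]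
    rw [sum_weighted_step (mixY_mulVec_weightY hp₂)]
    simp only [smul_add, Finset.sum_add_distrib]
    rw [sub_eq_add_neg]
    congr 1
    simp [weightY, driveY, Fintype.sum_sum_type, Finset.smul_sum, smul_comm μ]
  exact (WithLp.equiv 2 _).injective (Prod.ext hx hy)

theorem continuous_of_norm_sub_le {V : Type*} [NormedAddCommGroup V] {f : Vec M₁ → Vec M₂ → V}
    {L : ℝ} (h : ∀ x₁ x₂ y₁ y₂, ‖f x₁ y₁ - f x₂ y₂‖ ≤ L * (‖x₁ - x₂‖ + ‖y₁ - y₂‖)) :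
    Continuous fun z : Vec M₁ × Vec M₂ => f z.1 z.2 := by
  refine continuous_iff_continuousAt.2 fun z => ?_
  refine tendsto_iff_norm_sub_tendsto_zero.2 ?_
  refine squeeze_zero (fun _ => norm_nonneg _) (fun w => h w.1 z.1 w.2 z.2) ?_
  have : Continuous fun w : Vec M₁ × Vec M₂ => L * (‖w.1 - z.1‖ + ‖w.2 - z.2‖) := by fun_prop
  simpa using this.tendsto z

theorem LipschitzGradients.continuous_gradX (h : LipschitzGradients J Lf) (k : Agent K₁ K₂) :
    Continuous fun z : Vec M₁ × Vec M₂ => gradX (J k) z.1 z.2 :=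
  continuous_of_norm_sub_le (h.norm_gradX_sub_le k)

theorem LipschitzGradients.continuous_gradY (h : LipschitzGradients J Lf) (k : Agent K₁ K₂) :
    Continuous fun z : Vec M₁ × Vec M₂ => gradY (J k) z.1 z.2 :=
  continuous_of_norm_sub_le (h.norm_gradY_sub_le k)

theorem continuous_centroid : Continuous (centroid p : State K₁ K₂ M₁ M₂ → Joint M₁ M₂) := by
  refine (WithLp.prod_continuous_toLp 2 _ _).comp (Continuous.prodMk ?_ ?_) <;> fun_prop

theorem continuous_teamAverage {X : Type*} [TopologicalSpace X] {gx : X → Agent K₁ K₂ → Vec M₁}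
    {gy : X → Agent K₁ K₂ → Vec M₂} (hx : ∀ k, Continuous fun s => gx s k)
    (hy : ∀ k, Continuous fun s => gy s k) :
    Continuous fun s => teamAverage p (gx s) (gy s) := by
  refine (WithLp.prod_continuous_toLp 2 _ _).comp (Continuous.prodMk ?_ ?_) <;> fun_prop

theorem measurable_history {Ω : Type*} (s : ℕ → Ω → State K₁ K₂ M₁ M₂) (n : ℕ) :
    Measurable[history s n] (s n) :=
  measurable_iff_comap_le.2 (le_iSup₂_of_le n le_rfl le_rfl)

theorem stronglyMeasurable_history_comp {Ω : Type*} (s : ℕ → Ω → State K₁ K₂ M₁ M₂) (n : ℕ)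
    {V : Type*} [NormedAddCommGroup V] {φ : State K₁ K₂ M₁ M₂ → V} (hφ : Continuous φ) :
    StronglyMeasurable[history s n] fun ω => φ (s n ω) :=
  hφ.comp_stronglyMeasurable (measurable_history s n).stronglyMeasurable

variable {Ω : Type*} [mΩ : MeasurableSpace Ω] {P : Measure Ω}
  {gx : ℕ → Agent K₁ K₂ → Ω → Vec M₁ → Vec M₂ → Vec M₁}
  {gy : ℕ → Agent K₁ K₂ → Ω → Vec M₁ → Vec M₂ → Vec M₂} {s : ℕ → Ω → State K₁ K₂ M₁ M₂}

theorem GradientNoise.measurable_gradX (hN : GradientNoise P J gx gy s σ) {i : ℕ}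
    (hs : Measurable (s i)) (k : Agent K₁ K₂) :
    Measurable fun ω => gx i k ω (s i ω k).1 (s i ω k).2 :=
  (hN.measurable_x i k).comp
    (measurable_id.prodMk ((measurable_pi_apply k).comp hs))

theorem GradientNoise.measurable_gradY (hN : GradientNoise P J gx gy s σ) {i : ℕ}
    (hs : Measurable (s i)) (k : Agent K₁ K₂) :
    Measurable fun ω => gy i k ω (s i ω k).1 (s i ω k).2 :=
  (hN.measurable_y i k).comp
    (measurable_id.prodMk ((measurable_pi_apply k).comp hs))

theorem GradientNoise.measurable_driveX (hN : GradientNoise P J gx gy s σ) {i : ℕ}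
    (hs : Measurable (s i)) (l : Agent K₁ K₂) :
    Measurable fun ω => driveX (fun k => gx i k ω) (s i ω) l := by
  rcases l with l | l
  · exact (hN.measurable_gradX hs _).neg
  · exact hN.measurable_gradX hs _

theorem GradientNoise.measurable_driveY (hN : GradientNoise P J gx gy s σ) {i : ℕ}
    (hs : Measurable (s i)) (l : Agent K₁ K₂) :
    Measurable fun ω => driveY (fun k => gy i k ω) (s i ω) l := by
  rcases l with l | l
  · exact hN.measurable_gradY hs _
  · exact (hN.measurable_gradY hs _).neg

theorem GradientNoise.measurable_iterates (hN : GradientNoise P J gx gy s σ)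
    (hC : m.CrossTeam C) (hs : s = m.iterates A₁ A₂ C μ gx gy) (i : ℕ) : Measurable (s i) := by
  induction i with
  | zero => rw [hs]; exact measurable_const
  | succ i ih =>
    have hX := hN.measurable_driveX ih
    have hY := hN.measurable_driveY ih
    have hcoord : ∀ l, Measurable fun ω => s i ω l := fun l => (measurable_pi_apply l).comp ih
    have hstep : s (i + 1) = fun ω => Method.step A₁ A₂ C μ (fun k => gx i k ω)
        (fun k => gy i k ω) (s i ω) m := by rw [hs]; rfl
    refine measurable_pi_iff.2 fun k => ?_
    rw [hstep]
    refine Measurable.prod ?_ ?_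
    · simp only [Method.step_fst hC]
      exact Finset.measurable_sum _ fun l _ =>
        ((hcoord l).fst.add ((hX l).const_smul μ)).const_smul
          (mixX A₁ C l k)
    · simp only [Method.step_snd hC]
      exact Finset.measurable_sum _ fun l _ =>
        ((hcoord l).snd.add ((hY l).const_smul μ)).const_smul
          (mixY A₂ C l k)

theorem history_le (hs : ∀ i, Measurable (s i)) (n : ℕ) : history s n ≤ mΩ :=
  iSup₂_le fun j _ => (hs j).comap_le

/-- A random variable with integrable square and conditional second moment at most `σ²` has `L²`
norm at most `|σ|`. -/
theorem l2Le_of_condExp_le {Ω : Type*} {m mΩ : MeasurableSpace Ω} {P : Measure Ω}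
    [IsProbabilityMeasure P] {V : Type*} [NormedAddCommGroup V] (hm : m ≤ mΩ) {f : Ω → V}
    (hf : AEStronglyMeasurable f P) (hi : Integrable (fun ω => ‖f ω‖ ^ 2) P)
    (h : ∀ᵐ ω ∂P, (P[fun ω => ‖f ω‖ ^ 2 | m]) ω ≤ σ ^ 2) : L2Le P f |σ| := by
  refine l2Le_of_integral_sq_le hf hi ?_
  rw [← integral_condExp hm]
  refine (integral_mono_ae integrable_condExp (integrable_const (σ ^ 2)) h).trans_eq ?_
  simp

theorem GradientNoise.l2Le_noiseX [IsProbabilityMeasure P] (hN : GradientNoise P J gx gy s σ)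
    (hJ : LipschitzGradients J Lf) (hs : ∀ i, Measurable (s i)) (i : ℕ) (k : Agent K₁ K₂) :
    L2Le P (fun ω => gx i k ω (s i ω k).1 (s i ω k).2 - gradX (J k) (s i ω k).1 (s i ω k).2)
      |σ| :=
  l2Le_of_condExp_le (history_le hs i)
    ((hN.measurable_gradX (hs i) k).sub ((hJ.continuous_gradX k).measurable.comp
      ((measurable_pi_apply k).comp (hs i)))).aestronglyMeasurable
    (hN.integrable_x i k) (hN.variance_x i k)

theorem GradientNoise.l2Le_noiseY [IsProbabilityMeasure P] (hN : GradientNoise P J gx gy s σ)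
    (hJ : LipschitzGradients J Lf) (hs : ∀ i, Measurable (s i)) (i : ℕ) (k : Agent K₁ K₂) :
    L2Le P (fun ω => gy i k ω (s i ω k).1 (s i ω k).2 - gradY (J k) (s i ω k).1 (s i ω k).2)
      |σ| :=
  l2Le_of_condExp_le (history_le hs i)
    ((hN.measurable_gradY (hs i) k).sub ((hJ.continuous_gradY k).measurable.comp
      ((measurable_pi_apply k).comp (hs i)))).aestronglyMeasurable
    (hN.integrable_y i k) (hN.variance_y i k)

theorem memLp_comp_of_norm_sub_le [IsProbabilityMeasure P] {V : Type*} [NormedAddCommGroup V]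
    {f : Vec M₁ → Vec M₂ → V} {L : ℝ}
    (h : ∀ x₁ x₂ y₁ y₂, ‖f x₁ y₁ - f x₂ y₂‖ ≤ L * (‖x₁ - x₂‖ + ‖y₁ - y₂‖))
    {X : Ω → Vec M₁} {Y : Ω → Vec M₂} (hX : MemLp X 2 P) (hY : MemLp Y 2 P) :
    MemLp (fun ω => f (X ω) (Y ω)) 2 P := by
  have hg : MemLp (fun ω => L * (‖X ω‖ + ‖Y ω‖) + ‖f 0 0‖) 2 P :=
    ((hX.norm.add hY.norm).const_mul L).add (memLp_const _)
  refine hg.mono' ((continuous_of_norm_sub_le h).comp_aestronglyMeasurable (hX.1.prodMk hY.1))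
    (Eventually.of_forall fun ω => ?_)
  have h1 := h (X ω) 0 (Y ω) 0
  rw [sub_zero, sub_zero] at h1
  linarith [norm_le_norm_add_norm_sub' (f (X ω) (Y ω)) (f 0 0)]

theorem GradientNoise.memLp_gradX [IsProbabilityMeasure P] (hN : GradientNoise P J gx gy s σ)
    (hJ : LipschitzGradients J Lf) (hs : ∀ i, Measurable (s i)) {i : ℕ} {k : Agent K₁ K₂}
    (h₁ : MemLp (fun ω => (s i ω k).1) 2 P) (h₂ : MemLp (fun ω => (s i ω k).2) 2 P) :
    MemLp (fun ω => gx i k ω (s i ω k).1 (s i ω k).2) 2 P := by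
  refine ((hN.l2Le_noiseX hJ hs i k).1.add
    (memLp_comp_of_norm_sub_le (hJ.norm_gradX_sub_le k) h₁ h₂)).ae_eq ?_
  exact Eventually.of_forall fun ω => by simp

theorem GradientNoise.memLp_gradY [IsProbabilityMeasure P] (hN : GradientNoise P J gx gy s σ)
    (hJ : LipschitzGradients J Lf) (hs : ∀ i, Measurable (s i)) {i : ℕ} {k : Agent K₁ K₂}
    (h₁ : MemLp (fun ω => (s i ω k).1) 2 P) (h₂ : MemLp (fun ω => (s i ω k).2) 2 P) :
    MemLp (fun ω => gy i k ω (s i ω k).1 (s i ω k).2) 2 P := by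
  refine ((hN.l2Le_noiseY hJ hs i k).1.add
    (memLp_comp_of_norm_sub_le (hJ.norm_gradY_sub_le k) h₁ h₂)).ae_eq ?_
  exact Eventually.of_forall fun ω => by simp

/-- Lipschitz gradients grow at most linearly, so square integrability passes from one step to the
next; no uniform bound is claimed. -/
theorem GradientNoise.memLp_iterates [IsProbabilityMeasure P] (hN : GradientNoise P J gx gy s σ)
    (hJ : LipschitzGradients J Lf) (hC : m.CrossTeam C)
    (hs : s = m.iterates A₁ A₂ C μ gx gy) (i : ℕ) (k : Agent K₁ K₂) :
    MemLp (fun ω => (s i ω k).1) 2 P ∧ MemLp (fun ω => (s i ω k).2) 2 P := by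
  have hmeas := hN.measurable_iterates hC hs
  induction i generalizing k with
  | zero =>
    rw [hs]
    exact ⟨memLp_const (0 : Vec M₁), memLp_const (0 : Vec M₂)⟩
  | succ i ih =>
    have hgx : ∀ l, MemLp (fun ω => gx i l ω (s i ω l).1 (s i ω l).2) 2 P := fun l =>
      hN.memLp_gradX hJ hmeas (ih l).1 (ih l).2
    have hgy : ∀ l, MemLp (fun ω => gy i l ω (s i ω l).1 (s i ω l).2) 2 P := fun l =>
      hN.memLp_gradY hJ hmeas (ih l).1 (ih l).2
    have hX : ∀ l, MemLp (fun ω => driveX (fun k => gx i k ω) (s i ω) l) 2 P := by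
      rintro (l | l)
      · exact (hgx _).neg
      · exact hgx _
    have hY : ∀ l, MemLp (fun ω => driveY (fun k => gy i k ω) (s i ω) l) 2 P := by
      rintro (l | l)
      · exact hgy _
      · exact (hgy _).neg
    have hstep : s (i + 1) = fun ω => Method.step A₁ A₂ C μ (fun k => gx i k ω)
        (fun k => gy i k ω) (s i ω) m := by rw [hs]; rfl
    rw [hstep]
    simp only [Method.step_fst hC, Method.step_snd hC]
    exact ⟨memLp_finsetSum _ fun l _ => ((ih l).1.add ((hX l).const_smul μ)).const_smul
        (mixX A₁ C l k),
      memLp_finsetSum _ fun l _ => ((ih l).2.add ((hY l).const_smul μ)).const_smul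
        (mixY A₂ C l k)⟩

theorem GradientNoise.condExp_noiseX [IsProbabilityMeasure P] (hN : GradientNoise P J gx gy s σ)
    (hJ : LipschitzGradients J Lf) (hs : ∀ i, Measurable (s i))
    (hs2 : ∀ i k, MemLp (fun ω => (s i ω k).1) 2 P ∧ MemLp (fun ω => (s i ω k).2) 2 P)
    (i : ℕ) (k : Agent K₁ K₂) :
    P[fun ω => gx i k ω (s i ω k).1 (s i ω k).2 - gradX (J k) (s i ω k).1 (s i ω k).2
      | history s i] =ᵐ[P] 0 := by
  have hgrad := (memLp_comp_of_norm_sub_le (hJ.norm_gradX_sub_le k) (hs2 i k).1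
    (hs2 i k).2).integrable one_le_two
  have hg := (hN.memLp_gradX hJ hs (hs2 i k).1 (hs2 i k).2).integrable one_le_two
  have hm : StronglyMeasurable[history s i] fun ω => gradX (J k) (s i ω k).1 (s i ω k).2 :=
    stronglyMeasurable_history_comp s i
    ((hJ.continuous_gradX k).comp (continuous_apply k))
  refine (condExp_sub hg hgrad _).trans ?_
  filter_upwards [hN.unbiased_x i k] with ω h1
  rw [Pi.sub_apply, h1]
  rw [condExp_of_stronglyMeasurable (history_le hs i) hm hgrad]
  simp

theorem GradientNoise.condExp_noiseY [IsProbabilityMeasure P] (hN : GradientNoise P J gx gy s σ)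
    (hJ : LipschitzGradients J Lf) (hs : ∀ i, Measurable (s i))
    (hs2 : ∀ i k, MemLp (fun ω => (s i ω k).1) 2 P ∧ MemLp (fun ω => (s i ω k).2) 2 P)
    (i : ℕ) (k : Agent K₁ K₂) :
    P[fun ω => gy i k ω (s i ω k).1 (s i ω k).2 - gradY (J k) (s i ω k).1 (s i ω k).2
      | history s i] =ᵐ[P] 0 := by
  have hgrad := (memLp_comp_of_norm_sub_le (hJ.norm_gradY_sub_le k) (hs2 i k).1
    (hs2 i k).2).integrable one_le_two
  have hg := (hN.memLp_gradY hJ hs (hs2 i k).1 (hs2 i k).2).integrable one_le_two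
  have hm : StronglyMeasurable[history s i] fun ω => gradY (J k) (s i ω k).1 (s i ω k).2 :=
    stronglyMeasurable_history_comp s i
    ((hJ.continuous_gradY k).comp (continuous_apply k))
  refine (condExp_sub hg hgrad _).trans ?_
  filter_upwards [hN.unbiased_y i k] with ω h1
  rw [Pi.sub_apply, h1]
  rw [condExp_of_stronglyMeasurable (history_le hs i) hm hgrad]
  simp

end Dynamics

/-! ### Deviation of the agents from the centroid. -/

section Disagreement

variable {K₁ K₂ M₁ M₂ : ℕ} {p : Agent K₁ K₂ → ℝ} {J : Agent K₁ K₂ → Vec M₁ → Vec M₂ → ℝ}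
  {Lf G σ : ℝ} {A₁ : Matrix (Fin K₁) (Fin K₁) ℝ} {A₂ : Matrix (Fin K₂) (Fin K₂) ℝ}
  {C : Matrix (Agent K₁ K₂) (Agent K₁ K₂) ℝ} {m : Method} {μ : ℝ}
  {Ω : Type*} [mΩ : MeasurableSpace Ω] {P : Measure Ω}
  {gx : ℕ → Agent K₁ K₂ → Ω → Vec M₁ → Vec M₂ → Vec M₁}
  {gy : ℕ → Agent K₁ K₂ → Ω → Vec M₁ → Vec M₂ → Vec M₂} {s : ℕ → Ω → State K₁ K₂ M₁ M₂}

theorem norm_sub_le_three {V : Type*} [NormedAddCommGroup V] (a b c d : V) :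
    ‖a - d‖ ≤ ‖a - b‖ + ‖b - c‖ + ‖c - d‖ :=
  (norm_sub_le_norm_sub_add_norm_sub a c d).trans
    (add_le_add_left (norm_sub_le_norm_sub_add_norm_sub a b c) _)

/-- In the combination of the copies of the strategy of Team 1, all drifts that matter agree up to
noise, the bounded disagreement of the gradients and the disagreement of the iterates. -/
theorem GradientNoise.exists_drift_perturbationX (hN : GradientNoise P J gx gy s σ)
    (hJ : LipschitzGradients J Lf) (hG : BoundedDisagreement p J G) (hgame : m.GameClass p J)
    (hp : IsPerronVector A₁ (fun k => p (Sum.inl k))) (hC : m.CrossTeam C)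
    (hs : s = m.iterates A₁ A₂ C μ gx gy) :
    ∃ (v : ℕ → Ω → Vec M₁) (e : ℕ → Agent K₁ K₂ → Ω → Vec M₁),
      (∀ i k ω, (s (i + 1) ω k).1
        = ∑ l, mixX A₁ C l k • ((s i ω l).1 + μ • (v i ω + e i l ω))) ∧
      (∀ i l, Measurable (e i l)) ∧
      ∀ i l ω, ‖e i l ω‖ ≤
        ‖gx i l ω (s i ω l).1 (s i ω l).2 - gradX (J l) (s i ω l).1 (s i ω l).2‖ + |G| +
          |Lf| * (‖(s i ω l).1 - (centroid p (s i ω)).fst‖ +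
            ‖(s i ω l).2 - (centroid p (s i ω)).snd‖) := by
  have hmeas := hN.measurable_iterates hC hs
  have hlip := norm_gradX_teamCost₁_sub_le hJ (fun k => (hp.1 k).le) hp.2.1
  set v : ℕ → Ω → Vec M₁ := fun i ω =>
    -gradX (teamCost₁ p J) (centroid p (s i ω)).fst (centroid p (s i ω)).snd with hv
  set e₀ : ℕ → Agent K₁ K₂ → Ω → Vec M₁ := fun i l ω =>
    driveX (fun k => gx i k ω) (s i ω) l - v i ω with he₀
  have hvm : ∀ i, Measurable (v i) := fun i =>
    (((continuous_of_norm_sub_le hlip).comp ((WithLp.prod_continuous_ofLp 2 _ _).comp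
      continuous_centroid)).measurable.comp (hmeas i)).neg
  have he₀m : ∀ i l, Measurable (e₀ i l) := fun i l =>
    (hN.measurable_driveX (hmeas i) l).sub (hvm i)
  have hstep : ∀ i k ω, (s (i + 1) ω k).1
      = ∑ l, mixX A₁ C l k • ((s i ω l).1 + μ • (v i ω + e₀ i l ω)) := by
    intro i k ω
    have h : s (i + 1) ω = Method.step A₁ A₂ C μ (fun k => gx i k ω)
        (fun k => gy i k ω) (s i ω) m := by rw [hs]; rfl
    rw [h, Method.step_fst hC]
    simp only [he₀, add_sub_cancel]
  have hown : ∀ i l ω, ‖e₀ i (Sum.inl l) ω‖ ≤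
      ‖gx i (Sum.inl l) ω (s i ω (Sum.inl l)).1 (s i ω (Sum.inl l)).2 -
        gradX (J (Sum.inl l)) (s i ω (Sum.inl l)).1 (s i ω (Sum.inl l)).2‖ + |G| +
          |Lf| * (‖(s i ω (Sum.inl l)).1 - (centroid p (s i ω)).fst‖ +
            ‖(s i ω (Sum.inl l)).2 - (centroid p (s i ω)).snd‖) := by
    intro i l ω
    have h : e₀ i (Sum.inl l) ω = -(gx i (Sum.inl l) ω (s i ω (Sum.inl l)).1
        (s i ω (Sum.inl l)).2 -
        gradX (teamCost₁ p J) (centroid p (s i ω)).fst (centroid p (s i ω)).snd) := by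
      simp only [he₀, hv, driveX]
      abel
    rw [h, norm_neg]
    -- The intermediate points are the exact local gradient and the team gradient, both at the
    -- agent's iterate: the three pieces are noise, `G`, and the Lipschitz term.
    exact (norm_sub_le_three _ _ _ _).trans (add_le_add (add_le_add le_rfl
      ((hG (Sum.inl l) _ _).1.trans (le_abs_self G))) (hlip _ _ _ _))
  cases m with
  | atcItc =>
    refine ⟨v, e₀, hstep, he₀m, ?_⟩
    rintro i (l | l) ω
    · exact hown i l ω
    · have h : e₀ i (Sum.inr l) ω = gx i (Sum.inr l) ω (s i ω (Sum.inr l)).1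
          (s i ω (Sum.inr l)).2 -
          -gradX (teamCost₁ p J) (centroid p (s i ω)).fst (centroid p (s i ω)).snd := rfl
      rw [h]
      -- The same splitting for an estimating agent, whose drive has the opposite sign; `∇ₓ J⁽²⁾ =
      -- -∇ₓ J⁽¹⁾` makes `G` apply.
      refine (norm_sub_le_three _ (gradX (J (Sum.inr l)) (s i ω (Sum.inr l)).1
        (s i ω (Sum.inr l)).2) (-gradX (teamCost₁ p J) (s i ω (Sum.inr l)).1
        (s i ω (Sum.inr l)).2) _).trans (add_le_add (add_le_add le_rfl ?_) ?_)
      · have h1 := (hG (Sum.inr l) (s i ω (Sum.inr l)).1 (s i ω (Sum.inr l)).2).1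
        rw [ownTeamCost, ZeroSum.gradX_teamCost₂ hgame] at h1
        exact h1.trans (le_abs_self G)
      · rw [neg_sub_neg, norm_sub_rev]
        exact hlip _ _ _ _
  | atcC =>
    -- In ATC-C the rows of `mixX` indexed by Team 2 vanish, so its perturbations, which nothing
    -- would control, may be replaced by zero.
    refine ⟨v, fun i => Sum.elim (fun l => e₀ i (Sum.inl l)) fun _ _ => 0, ?_, ?_, ?_⟩
    · intro i k ω
      rw [hstep]
      refine Finset.sum_congr rfl fun l _ => ?_
      rcases l with l | l
      · rfl
      · have hzero : C.toBlocks₂₂ = 0 := hC.2.1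
        have : mixX A₁ C (Sum.inr l) k = 0 := by
          rcases k with k | k <;> simp [mixX, hzero]
        rw [this, zero_smul, zero_smul]
    · rintro i (l | l)
      · exact he₀m i (Sum.inl l)
      · exact measurable_const
    · rintro i (l | l) ω
      · exact hown i l ω
      · refine (norm_zero (E := Vec M₁)).trans_le ?_
        positivity

/-- In the combination of the copies of the strategy of Team 2, all drifts that matter agree up to
noise, the bounded disagreement of the gradients and the disagreement of the iterates. -/
theorem GradientNoise.exists_drift_perturbationY (hN : GradientNoise P J gx gy s σ)
    (hJ : LipschitzGradients J Lf) (hG : BoundedDisagreement p J G) (hgame : m.GameClass p J)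
    (hp : IsPerronVector A₂ (fun k => p (Sum.inr k))) (hC : m.CrossTeam C)
    (hs : s = m.iterates A₁ A₂ C μ gx gy) :
    ∃ (v : ℕ → Ω → Vec M₂) (e : ℕ → Agent K₁ K₂ → Ω → Vec M₂),
      (∀ i k ω, (s (i + 1) ω k).2
        = ∑ l, mixY A₂ C l k • ((s i ω l).2 + μ • (v i ω + e i l ω))) ∧
      (∀ i l, Measurable (e i l)) ∧
      ∀ i l ω, ‖e i l ω‖ ≤
        ‖gy i l ω (s i ω l).1 (s i ω l).2 - gradY (J l) (s i ω l).1 (s i ω l).2‖ + |G| +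
          |Lf| * (‖(s i ω l).1 - (centroid p (s i ω)).fst‖ +
            ‖(s i ω l).2 - (centroid p (s i ω)).snd‖) := by
  have hmeas := hN.measurable_iterates hC hs
  have hlip := norm_gradY_teamCost₂_sub_le hJ (fun k => (hp.1 k).le) hp.2.1
  set v : ℕ → Ω → Vec M₂ := fun i ω =>
    -gradY (teamCost₂ p J) (centroid p (s i ω)).fst (centroid p (s i ω)).snd with hv
  set e₀ : ℕ → Agent K₁ K₂ → Ω → Vec M₂ := fun i l ω =>
    driveY (fun k => gy i k ω) (s i ω) l - v i ω with he₀
  have hvm : ∀ i, Measurable (v i) := fun i =>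
    (((continuous_of_norm_sub_le hlip).comp ((WithLp.prod_continuous_ofLp 2 _ _).comp
      continuous_centroid)).measurable.comp (hmeas i)).neg
  have he₀m : ∀ i l, Measurable (e₀ i l) := fun i l =>
    (hN.measurable_driveY (hmeas i) l).sub (hvm i)
  have hstep : ∀ i k ω, (s (i + 1) ω k).2
      = ∑ l, mixY A₂ C l k • ((s i ω l).2 + μ • (v i ω + e₀ i l ω)) := by
    intro i k ω
    have h : s (i + 1) ω = Method.step A₁ A₂ C μ (fun k => gx i k ω)
        (fun k => gy i k ω) (s i ω) m := by rw [hs]; rfl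
    rw [h, Method.step_snd hC]
    simp only [he₀, add_sub_cancel]
  have hown : ∀ i l ω, ‖e₀ i (Sum.inr l) ω‖ ≤
      ‖gy i (Sum.inr l) ω (s i ω (Sum.inr l)).1 (s i ω (Sum.inr l)).2 -
        gradY (J (Sum.inr l)) (s i ω (Sum.inr l)).1 (s i ω (Sum.inr l)).2‖ + |G| +
          |Lf| * (‖(s i ω (Sum.inr l)).1 - (centroid p (s i ω)).fst‖ +
            ‖(s i ω (Sum.inr l)).2 - (centroid p (s i ω)).snd‖) := by
    intro i l ω
    have h : e₀ i (Sum.inr l) ω = -(gy i (Sum.inr l) ω (s i ω (Sum.inr l)).1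
        (s i ω (Sum.inr l)).2 -
        gradY (teamCost₂ p J) (centroid p (s i ω)).fst (centroid p (s i ω)).snd) := by
      simp only [he₀, hv, driveY]
      abel
    rw [h, norm_neg]
    exact (norm_sub_le_three _ _ _ _).trans (add_le_add (add_le_add le_rfl
      ((hG (Sum.inr l) _ _).2.trans (le_abs_self G))) (hlip _ _ _ _))
  cases m with
  | atcItc =>
    refine ⟨v, e₀, hstep, he₀m, ?_⟩
    rintro i (l | l) ω
    · have h : e₀ i (Sum.inl l) ω = gy i (Sum.inl l) ω (s i ω (Sum.inl l)).1
          (s i ω (Sum.inl l)).2 -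
          -gradY (teamCost₂ p J) (centroid p (s i ω)).fst (centroid p (s i ω)).snd := rfl
      rw [h]
      refine (norm_sub_le_three _ (gradY (J (Sum.inl l)) (s i ω (Sum.inl l)).1
        (s i ω (Sum.inl l)).2) (-gradY (teamCost₂ p J) (s i ω (Sum.inl l)).1
        (s i ω (Sum.inl l)).2) _).trans (add_le_add (add_le_add le_rfl ?_) ?_)
      · have h1 := (hG (Sum.inl l) (s i ω (Sum.inl l)).1 (s i ω (Sum.inl l)).2).2
        rw [ownTeamCost, ZeroSum.gradY_teamCost₁ hgame] at h1
        exact h1.trans (le_abs_self G)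
      · rw [neg_sub_neg, norm_sub_rev]
        exact hlip _ _ _ _
    · exact hown i l ω
  | atcC =>
    refine ⟨v, fun i => Sum.elim (fun _ _ => 0) fun l => e₀ i (Sum.inr l), ?_, ?_, ?_⟩
    · intro i k ω
      rw [hstep]
      refine Finset.sum_congr rfl fun l _ => ?_
      rcases l with l | l
      · have hzero : C.toBlocks₁₁ = 0 := hC.1
        have : mixY A₂ C (Sum.inl l) k = 0 := by
          rcases k with k | k <;> simp [mixY, hzero]
        rw [this, zero_smul, zero_smul]
      · rfl
    · rintro i (l | l)
      · exact measurable_const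
      · exact he₀m i (Sum.inr l)
    · rintro i (l | l) ω
      · refine (norm_zero (E := Vec M₂)).trans_le ?_
        positivity
      · exact hown i l ω

/-- The iterates of all agents stay within `O(μ)` of the centroid in mean square. -/
theorem GradientNoise.l2Le_disagreement [IsProbabilityMeasure P]
    (hN : GradientNoise P J gx gy s σ) (hJ : LipschitzGradients J Lf)
    (hG : BoundedDisagreement p J G) (hgame : m.GameClass p J)
    (hA₁ : WithinTeam A₁) (hA₂ : WithinTeam A₂)
    (hp₁ : IsPerronVector A₁ (fun k => p (Sum.inl k)))
    (hp₂ : IsPerronVector A₂ (fun k => p (Sum.inr k))) (hC : m.CrossTeam C)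
    (hs : s = m.iterates A₁ A₂ C μ gx gy) {S κ : ℝ} (hS0 : 0 ≤ S)
    (hSx : ∀ n l k, ∑ i ∈ Finset.range n, |(mixX A₁ C ^ (i + 1)) l k - weightX p l| ≤ S)
    (hSy : ∀ n l k, ∑ i ∈ Finset.range n, |(mixY A₂ C ^ (i + 1)) l k - weightY p l| ≤ S)
    (hκ : κ = Fintype.card (Agent K₁ K₂) * S) (hμ : 0 ≤ μ) (hμκ : 4 * |Lf| * κ * μ ≤ 1)
    (i : ℕ) (k : Agent K₁ K₂) :
    L2Le P (fun ω => (s i ω k).1 - (centroid p (s i ω)).fst) (2 * κ * (|σ| + |G|) * μ) ∧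
      L2Le P (fun ω => (s i ω k).2 - (centroid p (s i ω)).snd) (2 * κ * (|σ| + |G|) * μ) := by
  have hκ0 : 0 ≤ κ := by rw [hκ]; positivity
  have hmeas := hN.measurable_iterates hC hs
  have hCs := hC.leftStochastic
  obtain ⟨vx, ex, hxstep, hxm, hxle⟩ := hN.exists_drift_perturbationX hJ hG hgame hp₁ hC hs
  obtain ⟨vy, ey, hystep, hym, hyle⟩ := hN.exists_drift_perturbationY hJ hG hgame hp₂ hC hs
  set M := 2 * κ * (|σ| + |G|) * μ with hM
  have hM0 : 0 ≤ M := by positivity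
  have hR0 : 0 ≤ |σ| + |G| + |Lf| * (M + M) := by positivity
  -- Self-consistency of `M`: deviations at most `M` in the past reproduce the bound `M`, because
  -- the feedback `4 |Lf| κ μ` is at most one.
  have hMR : μ * κ * (|σ| + |G| + |Lf| * (M + M)) ≤ M := by
    have h1 : μ * κ * (|σ| + |G| + |Lf| * (M + M))
        = μ * κ * (|σ| + |G|) * (1 + 4 * |Lf| * κ * μ) := by rw [hM]; ring
    have h2 : M = μ * κ * (|σ| + |G|) * (1 + 1) := by rw [hM]; ring
    rw [h1, h2]
    gcongr
  -- The deviation at time `i` involves the whole past; at `i = 0` the past is empty and no base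
  -- case is needed.
  induction i using Nat.strong_induction_on generalizing k with
  | _ i ih =>
    have hGc := l2Le_const (P := P) |G|
    rw [abs_abs] at hGc
    have hD : ∀ j < i, ∀ l, L2Le P (fun ω => |Lf| *
        (‖(s j ω l).1 - (centroid p (s j ω)).fst‖ + ‖(s j ω l).2 - (centroid p (s j ω)).snd‖))
        (|Lf| * (M + M)) := by
      intro j hj l
      have h := ((ih j hj l).1.norm.add (ih j hj l).2.norm).smul |Lf|
      rwa [abs_abs] at h
    have hex : ∀ j < i, ∀ l, L2Le P (ex j l) (|σ| + |G| + |Lf| * (M + M)) := fun j hj l =>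
      (((hN.l2Le_noiseX hJ hmeas j l).norm.add hGc).add (hD j hj l)).of_norm_le
        (hxm j l).aestronglyMeasurable (hxle j l)
    have hey : ∀ j < i, ∀ l, L2Le P (ey j l) (|σ| + |G| + |Lf| * (M + M)) := fun j hj l =>
      (((hN.l2Le_noiseY hJ hmeas j l).norm.add hGc).add (hD j hj l)).of_norm_le
        (hym j l).aestronglyMeasurable (hyle j l)
    have h0 : ∀ k ω, s 0 ω k = 0 := by intro k ω; rw [hs]; rfl
    simp only [centroid_fst, centroid_snd]
    have hx := l2Le_sub_weighted_of_step (leftStochastic_mixX hA₁.2 hCs) (sum_weightX hp₁)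
      (mixX_mulVec_weightX hp₁) hSx (x := fun i k ω => (s i ω k).1) hμ hR0
      (fun k ω => by rw [h0]; rfl) hxstep i hex k
    have hy := l2Le_sub_weighted_of_step (leftStochastic_mixY hA₂.2 hCs) (sum_weightY hp₂)
      (mixY_mulVec_weightY hp₂) hSy (x := fun i k ω => (s i ω k).2) hμ hR0
      (fun k ω => by rw [h0]; rfl) hystep i hey k
    rw [← hκ] at hx hy
    exact ⟨hx.mono hMR, hy.mono hMR⟩

end Disagreement

/-! ### Perron averages over the teams in `L²`. -/

section Averages

variable {K₁ K₂ M₁ M₂ : ℕ} {p : Agent K₁ K₂ → ℝ} {Ω : Type*} [mΩ : MeasurableSpace Ω]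
  {P : Measure Ω}

theorem norm_col_le (x : Vec M₁) (y : Vec M₂) : ‖col x y‖ ≤ ‖x‖ + ‖y‖ := by
  refine le_of_sq_le_sq ?_ (by positivity)
  rw [Joint.norm_sq_eq]
  change ‖x‖ ^ 2 + ‖y‖ ^ 2 ≤ _
  nlinarith [norm_nonneg x, norm_nonneg y]

theorem L2Le.col {x : Ω → Vec M₁} {y : Ω → Vec M₂} {a b : ℝ} (hx : L2Le P x a) (hy : L2Le P y b) :
    L2Le P (fun ω => col (x ω) (y ω)) (a + b) :=
  (hx.norm.add hy.norm).of_norm_le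
    ((WithLp.prod_continuous_toLp 2 _ _).comp_aestronglyMeasurable (hx.1.1.prodMk hy.1.1))
    fun _ => norm_col_le _ _

theorem L2Le.weighted_sum {ι V : Type*} [Fintype ι] [NormedAddCommGroup V] [NormedSpace ℝ V]
    {q : ι → ℝ} (hq : ∀ k, 0 ≤ q k) (hq1 : ∑ k, q k = 1) {u : ι → Ω → V} {R : ℝ}
    (hu : ∀ k, L2Le P (u k) R) : L2Le P (fun ω => ∑ k, q k • u k ω) R := by
  refine (L2Le.sum fun k _ => (hu k).smul (q k)).mono (le_of_eq ?_)
  rw [← Finset.sum_mul]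
  simp only [abs_of_nonneg (hq _), hq1, one_mul]

theorem L2Le.teamAverage (hp₁ : ∀ k : Fin K₁, 0 ≤ p (Sum.inl k))
    (hs₁ : ∑ k : Fin K₁, p (Sum.inl k) = 1) (hp₂ : ∀ k : Fin K₂, 0 ≤ p (Sum.inr k))
    (hs₂ : ∑ k : Fin K₂, p (Sum.inr k) = 1) {ux : Agent K₁ K₂ → Ω → Vec M₁}
    {uy : Agent K₁ K₂ → Ω → Vec M₂} {R : ℝ} (hx : ∀ k, L2Le P (ux k) R)
    (hy : ∀ k, L2Le P (uy k) R) :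
    L2Le P (fun ω => TwoTeam.teamAverage p (fun k => ux k ω) (fun k => uy k ω)) (R + R) :=
  (L2Le.weighted_sum hp₁ hs₁ fun k => hx (Sum.inl k)).col
    (L2Le.weighted_sum hp₂ hs₂ fun k => hy (Sum.inr k))

theorem memLp_teamAverage {ux : Agent K₁ K₂ → Ω → Vec M₁} {uy : Agent K₁ K₂ → Ω → Vec M₂}
    (hx : ∀ k, MemLp (ux k) 2 P) (hy : ∀ k, MemLp (uy k) 2 P) :
    MemLp (fun ω => teamAverage p (fun k => ux k ω) (fun k => uy k ω)) 2 P :=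
  (L2Le.col ⟨memLp_finsetSum _ fun k _ => (hx (Sum.inl k)).const_smul (p (Sum.inl k)), le_rfl⟩
    ⟨memLp_finsetSum _ fun k _ => (hy (Sum.inr k)).const_smul (p (Sum.inr k)), le_rfl⟩).1

theorem memLp_fst {Z : Ω → Joint M₁ M₂} (h : MemLp Z 2 P) : MemLp (fun ω => (Z ω).fst) 2 P :=
  h.of_le ((WithLp.fstL 2 ℝ (Vec M₁) (Vec M₂)).continuous.comp_aestronglyMeasurable h.1)
    (Eventually.of_forall fun _ => WithLp.norm_fst_le _ _)

theorem memLp_snd {Z : Ω → Joint M₁ M₂} (h : MemLp Z 2 P) : MemLp (fun ω => (Z ω).snd) 2 P :=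
  h.of_le ((WithLp.sndL 2 ℝ (Vec M₁) (Vec M₂)).continuous.comp_aestronglyMeasurable h.1)
    (Eventually.of_forall fun _ => WithLp.norm_snd_le _ _)

theorem inner_teamAverage (z : Joint M₁ M₂) (ux : Agent K₁ K₂ → Vec M₁)
    (uy : Agent K₁ K₂ → Vec M₂) :
    inner ℝ z (teamAverage p ux uy)
      = ∑ k : Fin K₁, p (Sum.inl k) * inner ℝ z.fst (ux (Sum.inl k)) +
        ∑ k : Fin K₂, p (Sum.inr k) * inner ℝ z.snd (uy (Sum.inr k)) := by
  rw [WithLp.prod_inner_apply]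
  simp [teamAverage, TwoTeam.col, inner_sum, inner_smul_right]

/-- By linearity, orthogonality for each agent and each block suffices; no independence between
agents is involved. -/
theorem integral_inner_teamAverage_eq_zero [IsFiniteMeasure P] {Z : Ω → Joint M₁ M₂}
    (hZ : MemLp Z 2 P) {ux : Agent K₁ K₂ → Ω → Vec M₁} {uy : Agent K₁ K₂ → Ω → Vec M₂}
    (hx : ∀ k, MemLp (ux k) 2 P) (hy : ∀ k, MemLp (uy k) 2 P)
    (hx0 : ∀ k, ∫ ω, inner ℝ (Z ω).fst (ux k ω) ∂P = 0)
    (hy0 : ∀ k, ∫ ω, inner ℝ (Z ω).snd (uy k ω) ∂P = 0) :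
    ∫ ω, inner ℝ (Z ω) (teamAverage p (fun k => ux k ω) (fun k => uy k ω)) ∂P = 0 := by
  have hix : ∀ k : Fin K₁, Integrable
      (fun ω => p (Sum.inl k) * inner ℝ (Z ω).fst (ux (Sum.inl k) ω)) P := fun k =>
    (integrable_inner_of_memLp_two (memLp_fst hZ) (hx _)).const_mul _
  have hiy : ∀ k : Fin K₂, Integrable
      (fun ω => p (Sum.inr k) * inner ℝ (Z ω).snd (uy (Sum.inr k) ω)) P := fun k =>
    (integrable_inner_of_memLp_two (memLp_snd hZ) (hy _)).const_mul _
  simp only [inner_teamAverage]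
  rw [integral_add (integrable_finsetSum _ fun k _ => hix k)
    (integrable_finsetSum _ fun k _ => hiy k), integral_finsetSum _ fun k _ => hix k,
    integral_finsetSum _ fun k _ => hiy k]
  simp [integral_const_mul, hx0, hy0]

theorem gameOperator_eq_teamAverage {J : Agent K₁ K₂ → Vec M₁ → Vec M₂ → ℝ} {Lf : ℝ}
    (hJ : LipschitzGradients J Lf) (z : Joint M₁ M₂) :
    gameOperator p J z
      = teamAverage p (fun k => gradX (J k) z.fst z.snd) (fun k => gradY (J k) z.fst z.snd) := by
  rw [gameOperator, gradX_teamCost₁ hJ, gradY_teamCost₂ hJ]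
  rfl

end Averages

/-! ### The mean-square recursion. -/

section MeanSquare

/-- Young's inequality with weight `ν`: the loss `μν` on `‖a‖²` is half of the gain `2μν` from
monotonicity. -/
theorem norm_sub_smul_sq_le {V : Type*} [NormedAddCommGroup V] [NormedSpace ℝ V] (a b : V)
    {μ ν : ℝ} (hμ : 0 ≤ μ) (hν : 0 < ν) :
    ‖a - μ • b‖ ^ 2 ≤ (1 + μ * ν) * ‖a‖ ^ 2 + (μ ^ 2 + μ / ν) * ‖b‖ ^ 2 := by
  have h1 : ‖a - μ • b‖ ≤ ‖a‖ + μ * ‖b‖ := by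
    refine (norm_sub_le _ _).trans_eq ?_
    rw [norm_smul, Real.norm_of_nonneg hμ]
  have h2 := pow_le_pow_left₀ (norm_nonneg _) h1 2
  have h3 : 0 ≤ μ / ν * (ν * ‖a‖ - ‖b‖) ^ 2 := by positivity
  have h4 : μ / ν * (ν * ‖a‖ - ‖b‖) ^ 2
      = μ * ν * ‖a‖ ^ 2 - 2 * μ * (‖a‖ * ‖b‖) + μ / ν * ‖b‖ ^ 2 := by
    field_simp
    ring
  nlinarith

/-- To first order the product is `1 - μν`; the rest is at most `8 μ² L² ≤ μν / 2`. -/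
theorem contraction_factor_le {μ ν L : ℝ} (hμ : 0 ≤ μ) (hν : 0 < ν) (h1 : μ * ν ≤ 1)
    (h2 : 16 * L ^ 2 * μ ≤ ν) :
    (1 + μ * ν) * (1 - 2 * μ * ν + μ ^ 2 * (4 * L ^ 2)) ≤ 1 - μ * ν / 2 := by
  have h3 : 0 ≤ μ * ν := by positivity
  have h4 := mul_le_mul_of_nonneg_left h2 hμ
  have h5 : 0 ≤ (1 - μ * ν) * (μ ^ 2 * L ^ 2) := mul_nonneg (by linarith) (by positivity)
  nlinarith [sq_nonneg (μ * ν)]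

variable {K₁ K₂ M₁ M₂ : ℕ} {p : Agent K₁ K₂ → ℝ} {J : Agent K₁ K₂ → Vec M₁ → Vec M₂ → ℝ}
  {Lf ν σ : ℝ} {A₁ : Matrix (Fin K₁) (Fin K₁) ℝ} {A₂ : Matrix (Fin K₂) (Fin K₂) ℝ}
  {C : Matrix (Agent K₁ K₂) (Agent K₁ K₂) ℝ} {m : Method} {μ : ℝ}
  {Ω : Type*} [mΩ : MeasurableSpace Ω] {P : Measure Ω}
  {gx : ℕ → Agent K₁ K₂ → Ω → Vec M₁ → Vec M₂ → Vec M₁}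
  {gy : ℕ → Agent K₁ K₂ → Ω → Vec M₁ → Vec M₂ → Vec M₂} {s : ℕ → Ω → State K₁ K₂ M₁ M₂}

theorem GradientNoise.memLp_centroid_sub [IsProbabilityMeasure P]
    (hN : GradientNoise P J gx gy s σ) (hJ : LipschitzGradients J Lf) (hC : m.CrossTeam C)
    (hs : s = m.iterates A₁ A₂ C μ gx gy) (zs : Joint M₁ M₂) (i : ℕ) :
    MemLp (fun ω => centroid p (s i ω) - zs) 2 P :=
  (memLp_teamAverage (fun k => (hN.memLp_iterates hJ hC hs i k).1)
    (fun k => (hN.memLp_iterates hJ hC hs i k).2)).sub (memLp_const zs)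

theorem GradientNoise.memLp_agentIterate_sub [IsProbabilityMeasure P]
    (hN : GradientNoise P J gx gy s σ) (hJ : LipschitzGradients J Lf) (hC : m.CrossTeam C)
    (hs : s = m.iterates A₁ A₂ C μ gx gy) (zs : Joint M₁ M₂) (i : ℕ) (k : Agent K₁ K₂) :
    MemLp (fun ω => agentIterate k (s i ω) - zs) 2 P :=
  (L2Le.col ⟨(hN.memLp_iterates hJ hC hs i k).1, le_rfl⟩
    ⟨(hN.memLp_iterates hJ hC hs i k).2, le_rfl⟩).1.sub (memLp_const zs)

/-- One iteration contracts the mean-square error of the centroid, up to `O(μ²)`, when the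
iterates are within `M` of the centroid. -/
theorem GradientNoise.mse_centroid_succ_le [IsProbabilityMeasure P]
    (hN : GradientNoise P J gx gy s σ) (hJ : LipschitzGradients J Lf)
    (hν : StronglyMonotone p J ν) (hν0 : 0 < ν)
    (hp₁ : IsPerronVector A₁ (fun k => p (Sum.inl k)))
    (hp₂ : IsPerronVector A₂ (fun k => p (Sum.inr k))) (hC : m.CrossTeam C)
    (hs : s = m.iterates A₁ A₂ C μ gx gy) {zs : Joint M₁ M₂} (hzs : gameOperator p J zs = 0)
    (hμ : 0 ≤ μ) (hμν : μ * ν ≤ 1) (hμL : 16 * Lf ^ 2 * μ ≤ ν) {M : ℝ} {i : ℕ}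
    (hM : ∀ k, L2Le P (fun ω => (s i ω k).1 - (centroid p (s i ω)).fst) M ∧
      L2Le P (fun ω => (s i ω k).2 - (centroid p (s i ω)).snd) M) :
    mse P (fun ω => centroid p (s (i + 1) ω)) zs ≤
      (1 - μ * ν / 2) * mse P (fun ω => centroid p (s i ω)) zs +
        ((μ ^ 2 + μ / ν) * (4 * |Lf| * M) ^ 2 + 4 * σ ^ 2 * μ ^ 2) := by
  have hq₁ := fun k => (hp₁.1 k).le
  have hq₂ := fun k => (hp₂.1 k).le
  have hmeas := hN.measurable_iterates hC hs
  have hs2 := hN.memLp_iterates hJ hC hs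
  set avg : State K₁ K₂ M₁ M₂ → Joint M₁ M₂ := fun t =>
    teamAverage p (fun k => gradX (J k) (t k).1 (t k).2) (fun k => gradY (J k) (t k).1 (t k).2)
    with havg
  -- `Φ` is the next error without noise; being a continuous function of the current state, it is
  -- measurable with respect to the history and hence orthogonal to the noise.
  set Φ : State K₁ K₂ M₁ M₂ → Joint M₁ M₂ := fun t => centroid p t - zs - μ • avg t with hΦ
  have hΦc : Continuous Φ :=
    (continuous_centroid.sub continuous_const).sub
      ((continuous_teamAverage (fun k => (hJ.continuous_gradX k).comp (continuous_apply k))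
        (fun k => (hJ.continuous_gradY k).comp (continuous_apply k))).const_smul μ)
  have hZ2 : MemLp (fun ω => centroid p (s i ω) - zs) 2 P := hN.memLp_centroid_sub hJ hC hs zs i
  have hΦ2 : MemLp (fun ω => Φ (s i ω)) 2 P :=
    hZ2.sub ((memLp_teamAverage
      (fun k => memLp_comp_of_norm_sub_le (hJ.norm_gradX_sub_le k) (hs2 i k).1 (hs2 i k).2)
      (fun k => memLp_comp_of_norm_sub_le (hJ.norm_gradY_sub_le k) (hs2 i k).1
        (hs2 i k).2)).const_smul μ)
  set n : Ω → Joint M₁ M₂ := fun ω => teamAverage p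
    (fun k => gx i k ω (s i ω k).1 (s i ω k).2 - gradX (J k) (s i ω k).1 (s i ω k).2)
    (fun k => gy i k ω (s i ω k).1 (s i ω k).2 - gradY (J k) (s i ω k).1 (s i ω k).2) with hn
  have hnL : L2Le P n (|σ| + |σ|) := L2Le.teamAverage hq₁ hp₁.2.1 hq₂ hp₂.2.1
    (hN.l2Le_noiseX hJ hmeas i) (hN.l2Le_noiseY hJ hmeas i)
  have hcross : ∫ ω, inner ℝ (Φ (s i ω)) (n ω) ∂P = 0 :=
    integral_inner_teamAverage_eq_zero hΦ2 (fun k => (hN.l2Le_noiseX hJ hmeas i k).1)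
      (fun k => (hN.l2Le_noiseY hJ hmeas i k).1)
      (fun k => integral_inner_eq_zero_of_condExp_eq_zero (history_le hmeas i)
        (stronglyMeasurable_history_comp s i
          ((WithLp.fstL 2 ℝ (Vec M₁) (Vec M₂)).continuous.comp hΦc))
        (memLp_fst hΦ2) (hN.l2Le_noiseX hJ hmeas i k).1 (hN.condExp_noiseX hJ hmeas hs2 i k))
      (fun k => integral_inner_eq_zero_of_condExp_eq_zero (history_le hmeas i)
        (stronglyMeasurable_history_comp s i
          ((WithLp.sndL 2 ℝ (Vec M₁) (Vec M₂)).continuous.comp hΦc))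
        (memLp_snd hΦ2) (hN.l2Le_noiseY hJ hmeas i k).1 (hN.condExp_noiseY hJ hmeas hs2 i k))
  have hstep : ∀ ω, centroid p (s (i + 1) ω) - zs = Φ (s i ω) - μ • n ω := by
    intro ω
    have h : s (i + 1) ω = Method.step A₁ A₂ C μ (fun k => gx i k ω)
        (fun k => gy i k ω) (s i ω) m := by rw [hs]; rfl
    rw [h, centroid_step hp₁ hp₂ hC]
    simp only [hΦ, hn, havg, ← teamAverage_sub, smul_sub]
    abel
  -- The error from evaluating gradients at the agents' iterates instead of the centroid; it is
  -- controlled by the deviation `M`.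
  set b : Ω → Joint M₁ M₂ := fun ω => avg (s i ω) - gameOperator p J (centroid p (s i ω)) with hb
  have hbL : L2Le P b (4 * |Lf| * M) := by
    have hbe : b = fun ω => teamAverage p
        (fun k => gradX (J k) (s i ω k).1 (s i ω k).2 -
          gradX (J k) (centroid p (s i ω)).fst (centroid p (s i ω)).snd)
        (fun k => gradY (J k) (s i ω k).1 (s i ω k).2 -
          gradY (J k) (centroid p (s i ω)).fst (centroid p (s i ω)).snd) := by
      funext ω
      simp only [hb, havg, gameOperator_eq_teamAverage hJ, teamAverage_sub]
    have hD : ∀ k, L2Le P (fun ω => |Lf| *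
        (‖(s i ω k).1 - (centroid p (s i ω)).fst‖ + ‖(s i ω k).2 - (centroid p (s i ω)).snd‖))
        (|Lf| * (M + M)) := by
      intro k
      have h := ((hM k).1.norm.add (hM k).2.norm).smul |Lf|
      rwa [abs_abs] at h
    have hpair : ∀ k, Continuous fun t : State K₁ K₂ M₁ M₂ => t k := continuous_apply
    have hcent : Continuous fun t : State K₁ K₂ M₁ M₂ => WithLp.ofLp (centroid p t) :=
      (WithLp.prod_continuous_ofLp 2 _ _).comp continuous_centroid
    rw [hbe]
    refine (L2Le.teamAverage hq₁ hp₁.2.1 hq₂ hp₂.2.1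
      (fun k => (hD k).of_norm_le ?_ fun ω => hJ.norm_gradX_sub_le k _ _ _ _)
      (fun k => (hD k).of_norm_le ?_ fun ω => hJ.norm_gradY_sub_le k _ _ _ _)).mono
      (le_of_eq (by ring))
    · exact ((((hJ.continuous_gradX k).comp (hpair k)).sub
        ((hJ.continuous_gradX k).comp hcent)).measurable.comp (hmeas i)).aestronglyMeasurable
    · exact ((((hJ.continuous_gradY k).comp (hpair k)).sub
        ((hJ.continuous_gradY k).comp hcent)).measurable.comp (hmeas i)).aestronglyMeasurable
  have hΦle : ∀ ω, ‖Φ (s i ω)‖ ^ 2 ≤ (1 - μ * ν / 2) * ‖centroid p (s i ω) - zs‖ ^ 2 +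
      (μ ^ 2 + μ / ν) * ‖b ω‖ ^ 2 := by
    intro ω
    have h1 := norm_sub_smul_gameOperator_sq_le hJ hq₁ hp₁.2.1 hq₂ hp₂.2.1 hν hμ
      (centroid p (s i ω)) zs
    rw [hzs, smul_zero, sub_zero] at h1
    have h2 := norm_sub_smul_sq_le (centroid p (s i ω) - μ • gameOperator p J (centroid p (s i ω))
      - zs) (b ω) hμ hν0
    have h3 : Φ (s i ω) = centroid p (s i ω) - μ • gameOperator p J (centroid p (s i ω)) - zs -
        μ • b ω := by
      simp only [hΦ, hb, smul_sub]
      abel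
    rw [h3]
    refine h2.trans (add_le_add_left ?_ _)
    refine (mul_le_mul_of_nonneg_left h1 (by positivity)).trans ?_
    rw [← mul_assoc]
    exact mul_le_mul_of_nonneg_right (contraction_factor_le hμ hν0 hμν hμL) (sq_nonneg _)
  have hZi := (memLp_two_iff_integrable_sq_norm hZ2.1).1 hZ2
  have hΦi := (memLp_two_iff_integrable_sq_norm hΦ2.1).1 hΦ2
  have hΦint : ∫ ω, ‖Φ (s i ω)‖ ^ 2 ∂P ≤
      (1 - μ * ν / 2) * mse P (fun ω => centroid p (s i ω)) zs +
        (μ ^ 2 + μ / ν) * (4 * |Lf| * M) ^ 2 := by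
    refine (integral_mono hΦi ((hZi.const_mul _).add (hbL.integrable_sq.const_mul _)) hΦle).trans ?_
    rw [integral_add' (hZi.const_mul _) (hbL.integrable_sq.const_mul _), integral_const_mul,
      integral_const_mul]
    exact add_le_add_right (mul_le_mul_of_nonneg_left hbL.integral_sq_le (by positivity)) _
  have hexp : mse P (fun ω => centroid p (s (i + 1) ω)) zs
      = ∫ ω, ‖Φ (s i ω)‖ ^ 2 ∂P + μ ^ 2 * ∫ ω, ‖n ω‖ ^ 2 ∂P := by
    have hpt : ∀ ω, ‖centroid p (s (i + 1) ω) - zs‖ ^ 2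
        = ‖Φ (s i ω)‖ ^ 2 - 2 * μ * inner ℝ (Φ (s i ω)) (n ω) + μ ^ 2 * ‖n ω‖ ^ 2 := by
      intro ω
      rw [hstep, norm_sub_sq_real, inner_smul_right, norm_smul, mul_pow, Real.norm_eq_abs, sq_abs]
      ring
    have hinner := (integrable_inner_of_memLp_two hΦ2 hnL.1).const_mul (2 * μ)
    simp only [mse, hpt]
    rw [integral_add (f := fun ω => ‖Φ (s i ω)‖ ^ 2 - 2 * μ * inner ℝ (Φ (s i ω)) (n ω))
      (hΦi.sub hinner) (hnL.integrable_sq.const_mul _), integral_sub hΦi hinner,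
      integral_const_mul, integral_const_mul, hcross, mul_zero, sub_zero]
  have hn4 : ∫ ω, ‖n ω‖ ^ 2 ∂P ≤ 4 * σ ^ 2 := by
    refine hnL.integral_sq_le.trans_eq ?_
    rw [← two_mul, mul_pow, sq_abs]
    norm_num
  rw [hexp]
  linarith [mul_le_mul_of_nonneg_left hn4 (sq_nonneg μ)]

theorem GradientNoise.mse_agentIterate_le [IsProbabilityMeasure P]
    (hN : GradientNoise P J gx gy s σ) (hJ : LipschitzGradients J Lf) (hC : m.CrossTeam C)
    (hs : s = m.iterates A₁ A₂ C μ gx gy) (zs : Joint M₁ M₂) {M : ℝ} {i : ℕ} {k : Agent K₁ K₂}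
    (hM : L2Le P (fun ω => (s i ω k).1 - (centroid p (s i ω)).fst) M ∧
      L2Le P (fun ω => (s i ω k).2 - (centroid p (s i ω)).snd) M) :
    mse P (fun ω => agentIterate k (s i ω)) zs ≤
      2 * (2 * M) ^ 2 + 2 * mse P (fun ω => centroid p (s i ω)) zs := by
  have hd := hM.1.col hM.2
  rw [← two_mul] at hd
  have hZ2 : MemLp (fun ω => centroid p (s i ω) - zs) 2 P := hN.memLp_centroid_sub hJ hC hs zs i
  have hA2 := hN.memLp_agentIterate_sub hJ hC hs zs i k
  have hZi := (memLp_two_iff_integrable_sq_norm hZ2.1).1 hZ2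
  have hAi := (memLp_two_iff_integrable_sq_norm hA2.1).1 hA2
  have hpt : ∀ ω, ‖agentIterate k (s i ω) - zs‖ ^ 2 ≤
      2 * ‖col ((s i ω k).1 - (centroid p (s i ω)).fst)
          ((s i ω k).2 - (centroid p (s i ω)).snd)‖ ^ 2
        + 2 * ‖centroid p (s i ω) - zs‖ ^ 2 := by
    intro ω
    have h : agentIterate k (s i ω) - zs =
        col ((s i ω k).1 - (centroid p (s i ω)).fst) ((s i ω k).2 - (centroid p (s i ω)).snd) +
          (centroid p (s i ω) - zs) := by
      have : col ((s i ω k).1 - (centroid p (s i ω)).fst)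
          ((s i ω k).2 - (centroid p (s i ω)).snd) =
          agentIterate k (s i ω) - centroid p (s i ω) := rfl
      rw [this]
      abel
    rw [h]
    have h1 := pow_le_pow_left₀ (norm_nonneg _) (norm_add_le
      (col ((s i ω k).1 - (centroid p (s i ω)).fst) ((s i ω k).2 - (centroid p (s i ω)).snd))
      (centroid p (s i ω) - zs)) 2
    nlinarith [sq_nonneg (‖col ((s i ω k).1 - (centroid p (s i ω)).fst)
      ((s i ω k).2 - (centroid p (s i ω)).snd)‖ - ‖centroid p (s i ω) - zs‖)]
  refine (integral_mono hAi ((hd.integrable_sq.const_mul _).add (hZi.const_mul _)) hpt).trans ?_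
  rw [integral_add' (hd.integrable_sq.const_mul _) (hZi.const_mul _), integral_const_mul,
    integral_const_mul]
  exact add_le_add_left (mul_le_mul_of_nonneg_left hd.integral_sq_le (by norm_num)) _

end MeanSquare

/-! ### From the recursion to the limit superior. -/

section Limsup

/-- `c'` is a supersolution of the fixed-point equation `c' = d c' + c`; only the initial error is
damped by `d ^ i`. -/
theorem le_pow_mul_add_of_recursion {e : ℕ → ℝ} {d c c' : ℝ} (hd : 0 ≤ d) (hc' : 0 ≤ c')
    (hfix : d * c' + c ≤ c') (h : ∀ i, e (i + 1) ≤ d * e i + c) (i : ℕ) :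
    e i ≤ d ^ i * e 0 + c' := by
  induction i with
  | zero => simpa using hc'
  | succ i ih =>
    calc e (i + 1) ≤ d * (d ^ i * e 0 + c') + c :=
          (h i).trans (add_le_add_left (mul_le_mul_of_nonneg_left ih hd) _)
      _ ≤ d ^ (i + 1) * e 0 + c' := by rw [pow_succ]; linarith

theorem limsup_coe_le_of_le_pow_mul_add {e : ℕ → ℝ} {d K c B : ℝ} (hd : 0 ≤ d) (hd1 : d < 1)
    (h : ∀ i, e i ≤ d ^ i * K + c) (hcB : c ≤ B) :
    limsup (fun i => (e i : EReal)) atTop ≤ (B : EReal) := by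
  have ht : Tendsto (fun i : ℕ => ((d ^ i * K + c : ℝ) : EReal)) atTop
      (nhds ((c : ℝ) : EReal)) := by
    refine EReal.tendsto_coe.2 ?_
    simpa using ((tendsto_pow_atTop_nhds_zero_of_lt_one hd hd1).mul_const K).add_const c
  refine (limsup_le_limsup (Eventually.of_forall fun i => ?_)).trans
    (ht.limsup_eq.trans_le (EReal.coe_le_coe_iff.2 hcB))
  exact EReal.coe_le_coe_iff.2 (h i)

end Limsup

end TwoTeam

end

/-! ### Choice of the constants and conclusion. -/

theorem theorem1 :
    -- the contraction factor is a function of `μ`, `ν` and `Lf` only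
    ∃ d : ℝ → ℝ → ℝ → ℝ,
    ∀ (m : TwoTeam.Method) (K₁ K₂ M₁ M₂ : ℕ)
      (A₁ : Matrix (Fin K₁) (Fin K₁) ℝ) (A₂ : Matrix (Fin K₂) (Fin K₂) ℝ)
      (C : Matrix (TwoTeam.Agent K₁ K₂) (TwoTeam.Agent K₁ K₂) ℝ)
      (p : TwoTeam.Agent K₁ K₂ → ℝ),
      TwoTeam.WithinTeam A₁ → TwoTeam.WithinTeam A₂ →
      TwoTeam.IsPerronVector A₁ (fun k => p (Sum.inl k)) →
      TwoTeam.IsPerronVector A₂ (fun k => p (Sum.inr k)) →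
      m.CrossTeam C →
    -- `α` depends only on the method and the matrices
    ∃ α : ℝ, 0 < α ∧ α < 1 ∧
    ∀ ν Lf G σ : ℝ, 0 < ν →
    -- the constants below depend on the matrices and on `ν`, `Lf`, `G`, `σ` only
    ∃ μ₀ B c : ℝ, 0 < μ₀ ∧ 0 < c ∧
    (∀ μ : ℝ, 0 < μ → μ < μ₀ → 0 ≤ d μ ν Lf ∧ d μ ν Lf < 1) ∧
    ∀ J : TwoTeam.Agent K₁ K₂ → TwoTeam.Vec M₁ → TwoTeam.Vec M₂ → ℝ,
      m.GameClass p J →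
      TwoTeam.StronglyMonotone p J ν →
      TwoTeam.LipschitzGradients J Lf →
      TwoTeam.BoundedDisagreement p J G →
    ∃ zs : TwoTeam.Joint M₁ M₂,
      TwoTeam.IsNash p J zs ∧ (∀ z, TwoTeam.IsNash p J z → z = zs) ∧
      ∀ μ : ℝ, 0 < μ → μ < μ₀ →
      ∀ (Ω : Type*) [MeasurableSpace Ω] (P : Measure Ω) [IsProbabilityMeasure P]
        (gx : ℕ → TwoTeam.Agent K₁ K₂ → Ω →
          TwoTeam.Vec M₁ → TwoTeam.Vec M₂ → TwoTeam.Vec M₁)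
        (gy : ℕ → TwoTeam.Agent K₁ K₂ → Ω →
          TwoTeam.Vec M₁ → TwoTeam.Vec M₂ → TwoTeam.Vec M₂)
        (s : ℕ → Ω → TwoTeam.State K₁ K₂ M₁ M₂),
        s = m.iterates A₁ A₂ C μ gx gy →
        TwoTeam.GradientNoise P J gx gy s σ →
        -- all mean-square errors are finite
        (∀ n, Integrable (fun ω => ‖TwoTeam.centroid p (s n ω) - zs‖ ^ 2) P) ∧
        (∀ n k, Integrable (fun ω => ‖TwoTeam.agentIterate k (s n ω) - zs‖ ^ 2) P) ∧
        -- iteration `i` leads from state `i` to state `i + 1`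
        (∀ i : ℕ, Real.log (c * μ ^ 2) / Real.log α ≤ (i : ℝ) →
          TwoTeam.mse P (fun ω => TwoTeam.centroid p (s (i + 1) ω)) zs ≤
            d μ ν Lf * TwoTeam.mse P (fun ω => TwoTeam.centroid p (s i ω)) zs + B * μ ^ 2) ∧
        limsup (fun i : ℕ =>
          ((TwoTeam.mse P (fun ω => TwoTeam.centroid p (s i ω)) zs : ℝ) : EReal)) atTop
            ≤ ((B * μ : ℝ) : EReal) ∧
        ∀ k, limsup (fun i : ℕ =>
          ((TwoTeam.mse P (fun ω => TwoTeam.agentIterate k (s i ω)) zs : ℝ) : EReal)) atTop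
            ≤ ((B * μ : ℝ) : EReal) := by
  refine ⟨fun μ ν _ => 1 - μ * ν / 2, ?_⟩
  intro m K₁ K₂ M₁ M₂ A₁ A₂ C p hA₁ hA₂ hp₁ hp₂ hC
  -- The recursion has no transient, so any `α` in `(0, 1)` serves, and later `c = 1`.
  refine ⟨1 / 2, by norm_num, by norm_num, ?_⟩
  intro ν Lf G σ hν
  obtain ⟨Sx, hSx0, hSx⟩ := TwoTeam.exists_sum_abs_mixX_pow_sub_le hA₁ hp₁ hC
  obtain ⟨Sy, hSy0, hSy⟩ := TwoTeam.exists_sum_abs_mixY_pow_sub_le hA₂ hp₂ hC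
  set κ : ℝ := Fintype.card (TwoTeam.Agent K₁ K₂) * (Sx + Sy) with hκ
  have hκ0 : 0 ≤ κ := by positivity
  set r : ℝ := 2 * κ * (|σ| + |G|) with hr
  have hr0 : 0 ≤ r := by positivity
  -- The remainder of the recursion for `M = r μ`, divided by `μ²`, after `μ² + μ / ν ≤ 1 + 1 / ν`
  -- for `μ ≤ 1`.
  set D : ℝ := (1 + 1 / ν) * (4 * |Lf| * r) ^ 2 + 4 * σ ^ 2 with hD
  have hD0 : 0 ≤ D := by positivity
  have hL : 0 < 4 * |Lf| * κ + 1 := by positivity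
  have hL2 : 0 < 16 * Lf ^ 2 + 1 := by positivity
  -- The four bounds on `μ` give `μ < 1`, `μν < 1`, `16 Lf² μ ≤ ν` and `4 |Lf| κ μ ≤ 1`; the added
  -- ones avoid zero denominators. In `B`, `D` serves the recursion, and `4D/ν + 8r²` the limits for
  -- the agents, which dominates the `2D/ν` of the centroid.
  refine ⟨min (min 1 (1 / ν)) (min (ν / (16 * Lf ^ 2 + 1)) (1 / (4 * |Lf| * κ + 1))),
    D + 4 * D / ν + 8 * r ^ 2, 1, by positivity, one_pos, ?_, ?_⟩
  · intro μ hμ0 hμ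
    simp only [lt_min_iff] at hμ
    have h1 : μ * ν < 1 := (lt_div_iff₀ hν).1 hμ.1.2
    have h2 : 0 < μ * ν := mul_pos hμ0 hν
    constructor <;> linarith
  intro J hgame hmono hJ hG
  obtain ⟨zs, hzs⟩ := TwoTeam.exists_gameOperator_eq_zero hJ (fun k => (hp₁.1 k).le) hp₁.2.1
    (fun k => (hp₂.1 k).le) hp₂.2.1 hmono hν
  refine ⟨zs, hmono.isNash_of_gameOperator_eq_zero hJ hν hzs,
    fun z hz => hmono.eq_of_gameOperator_eq_zero hν hz.gameOperator_eq_zero hzs, ?_⟩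
  intro μ hμ0 hμ Ω _ P _ gx gy s hs hN
  simp only [lt_min_iff] at hμ
  obtain ⟨⟨hμ1, hμν⟩, hμL, hμκ⟩ := hμ
  rw [lt_div_iff₀ hν] at hμν
  rw [lt_div_iff₀ hL2] at hμL
  rw [lt_div_iff₀ hL] at hμκ
  have hμsq : μ ^ 2 ≤ μ := by nlinarith
  have hM := hN.l2Le_disagreement hJ hG hgame hA₁ hA₂ hp₁ hp₂ hC hs (add_nonneg hSx0 hSy0)
    (fun n l k => (hSx n l k).trans (le_add_of_nonneg_right hSy0))
    (fun n l k => (hSy n l k).trans (le_add_of_nonneg_left hSx0)) hκ hμ0.le (by linarith)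
  rw [← hr] at hM
  have hrec : ∀ i, TwoTeam.mse P (fun ω => TwoTeam.centroid p (s (i + 1) ω)) zs ≤
      (1 - μ * ν / 2) * TwoTeam.mse P (fun ω => TwoTeam.centroid p (s i ω)) zs + D * μ ^ 2 := by
    intro i
    refine (hN.mse_centroid_succ_le hJ hmono hν hp₁ hp₂ hC hs hzs hμ0.le hμν.le (by linarith)
      (hM i)).trans (add_le_add_right ?_ _)
    have h1 : μ ^ 2 + μ / ν ≤ 1 + 1 / ν :=
      add_le_add (by linarith) (div_le_div_of_nonneg_right hμ1.le hν.le)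
    have h2 := mul_le_mul_of_nonneg_right h1 (sq_nonneg (4 * |Lf| * (r * μ)))
    calc _ ≤ (1 + 1 / ν) * (4 * |Lf| * (r * μ)) ^ 2 + 4 * σ ^ 2 * μ ^ 2 := add_le_add_left h2 _
      _ = D * μ ^ 2 := by rw [hD]; ring
  have hd0 : 0 ≤ 1 - μ * ν / 2 := by linarith
  have hd1 : 1 - μ * ν / 2 < 1 := by linarith [mul_pos hμ0 hν]
  have hDν : 0 ≤ D / ν := by positivity
  -- The fixed point of `c' = (1 - μν/2) c' + D μ²` is `2 D μ / ν`: dividing by `μν/2` loses one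
  -- power of `μ`.
  have hmse : ∀ i, TwoTeam.mse P (fun ω => TwoTeam.centroid p (s i ω)) zs ≤
      (1 - μ * ν / 2) ^ i * TwoTeam.mse P (fun ω => TwoTeam.centroid p (s 0 ω)) zs +
        2 * (D / ν) * μ := by
    refine TwoTeam.le_pow_mul_add_of_recursion
      (e := fun i => TwoTeam.mse P (fun ω => TwoTeam.centroid p (s i ω)) zs) hd0
      (by positivity) (le_of_eq ?_) hrec
    field_simp
    ring
  have hB : D + 4 * D / ν + 8 * r ^ 2 = D + 4 * (D / ν) + 8 * r ^ 2 := by rw [mul_div_assoc]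
  have hDμ : 0 ≤ D * μ := by positivity
  have hDνμ : 0 ≤ D / ν * μ := by positivity
  have hrμ : 0 ≤ r ^ 2 * μ := by positivity
  refine ⟨fun n => (memLp_two_iff_integrable_sq_norm (hN.memLp_centroid_sub hJ hC hs zs n).1).1
      (hN.memLp_centroid_sub hJ hC hs zs n),
    fun n k => (memLp_two_iff_integrable_sq_norm
      (hN.memLp_agentIterate_sub hJ hC hs zs n k).1).1
      (hN.memLp_agentIterate_sub hJ hC hs zs n k), ?_, ?_, ?_⟩
  · intro i _
    refine (hrec i).trans (add_le_add_right (mul_le_mul_of_nonneg_right ?_ (sq_nonneg μ)) _)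
    rw [hB]
    linarith [sq_nonneg r]
  · refine TwoTeam.limsup_coe_le_of_le_pow_mul_add hd0 hd1 hmse ?_
    rw [hB]
    linarith
  · intro k
    refine TwoTeam.limsup_coe_le_of_le_pow_mul_add hd0 hd1
      (K := 2 * TwoTeam.mse P (fun ω => TwoTeam.centroid p (s 0 ω)) zs)
      (c := 8 * r ^ 2 * μ ^ 2 + 4 * (D / ν) * μ) (fun i => ?_) ?_
    · refine (hN.mse_agentIterate_le hJ hC hs zs (hM i k)).trans ?_
      linarith [hmse i]
    · rw [hB]
      linarith [mul_le_mul_of_nonneg_left hμsq (sq_nonneg r)]
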